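/- Let $\mathbb F\in\{\mathbb R,\mathbb C\}$, let $G$ be a locally compact Hausdorff étale groupoid with range and domain maps $r,d$ and unit space $X$, and let $\mathcal L=\bigsqcup_{\gamma\in G}L_\gamma$ be a twist over $G$, that is, a Fell line bundle: a topological space whose fibres are one-dimensional Banach spaces over $\mathbb F$, with continuous open projection onto $G$ and continuous fibrewise addition, scalar multiplication and norm, equipped with a continuous associative bilinear multiplication $L_\gamma\times L_\eta\to L_{\gamma\eta}$ (for $d(\gamma)=r(\eta)$) for which the norm is multiplicative, and with a continuous conjugate-linear isometric antimultiplicative involution $L_\gamma\to L_{\gamma^{-1}}$ with $z\cdot z^*=|z|^2$, where $\mathcal L|_X=X\times\mathbb F$. Let $C_c(G,\mathcal L)$ be the algebra of continuous compactly supported sections with the convolution product $(f*g)(\gamma)=\sum_{r(\eta)=r(\gamma)}f(\eta)\cdot g(\eta^{-1}\gamma)$. The groupoid $G$ is *topologically free* if there is no non-empty open set $V\subseteq G\setminus X$ with $r|_V=d|_V$; *minimal* if the only open sets $U\subseteq X$ such that $d(\gamma)\in U$ implies $r(\gamma)\in U$ are $\emptyset$ and $X$; and *topologically principal* if the set of units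 with non-trivial isotropy group has empty interior. A Banach algebra is *simple* if it has no closed two-sided ideals other than $0$ and itself. Let $S$ be a unital inverse subsemigroup of the inverse semigroup of open bisections of $G$ that covers $G$. An *$S$-graded twisted groupoid Banach algebra* $F_{\mathcal R}(G,\mathcal L)$ is the Banach algebra Hausdorff completion of $C_c(G,\mathcal L)$ in a submultiplicative seminorm $\|\cdot\|_{\mathcal R}$ with $\|f\|_{\mathcal R}\le\|f\|_\infty$ for all $f\in C_c(U,\mathcal L)$, $U\in S$. It is *reduced* if $\|\cdot\|_{\mathcal R}=\|\cdot\|_\infty$ on $C_c(X)$ (so that $C_0(X)\subseteq F_{\mathcal R}(G,\mathcal L)$) and the inclusion $C_c(G,\mathcal L)\subseteq C_0(G,\mathcal L)$ extends to an injective linear contraction $F_{\mathcal R}(G,\mathcal L)\to C_0(G,\mathcal L)$. 1. For every covering unital inverse semigroup $S$ of open bisections and every reduced $S$-graded twisted groupoid Banach algebra $F_{\mathcal R}(G,\mathcal L)$, the following are equivalent: (a) $F_{\mathcal R}(G,\mathcal L)$ is simple and contains $C_0(X)$ as a maximal abelian subalgebra; (b) $G$ is topologically free and minimal. 2. For every non-empty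 $P\subseteq[1,\infty]$, the equivalence of (a) and (b) holds for the reduced $L^P$-operator algebra $F^P_{\mathrm{red}}(G,\mathcal L)$, the completion of $C_c(G,\mathcal L)$ in the norm $\sup_{p\in P}\|f\|_{L^p,\mathrm{red}}$, where $\|f\|_{L^p,\mathrm{red}}$ is the norm of the operator $\xi\mapsto f*\xi$ on $\ell^p(G,\mathcal L)$. 3. If $G$ is topologically principal and minimal, then $F^p_{\mathrm{red}}(G,\mathcal L)$ is simple for every $p\in[1,\infty]$. For the trivial twist, second countable $G$ and $p\in(1,\infty)$ this is a positive answer to Problem 8.2 of Gardella and Lupini. -/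

import Mathlib

open Bundle Topology Filter
open scoped ENNReal

/-! ### Étale groupoids -/

/-- A groupoid, presented by its set `G` of arrows. The units are identified with the identity
arrows, so that range and domain are maps `G → G`. The value `comp γ η` has a meaning only if
`d γ = r η`; nothing is required of it, and it is never used, for other pairs. -/
class ArrowGroupoid (G : Type*) where
  /-- range -/
  r : G → G
  /-- domain -/
  d : G → G
  /-- composition of composable arrows -/
  comp : G → G → G
  /-- inverse -/
  inv : G → G
  d_r : ∀ γ, d (r γ) = r γ
  r_d : ∀ γ, r (d γ) = d γ
  r_comp : ∀ γ η, d γ = r η → r (comp γ η) = r γ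
  d_comp : ∀ γ η, d γ = r η → d (comp γ η) = d η
  comp_assoc : ∀ α β γ, d α = r β → d β = r γ → comp (comp α β) γ = comp α (comp β γ)
  r_comp_self : ∀ γ, comp (r γ) γ = γ
  comp_d_self : ∀ γ, comp γ (d γ) = γ
  r_inv : ∀ γ, r (inv γ) = d γ
  d_inv : ∀ γ, d (inv γ) = r γ
  comp_inv : ∀ γ, comp γ (inv γ) = r γ
  inv_comp : ∀ γ, comp (inv γ) γ = d γ

/-- An étale groupoid: a topological groupoid whose range map is a local homeomorphism onto the
unit space, the unit space being open. (Both are expressed by saying that the range map is a local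
homeomorphism as a map `G → G`; the domain map is the range map after inversion.) -/
class EtaleGroupoid (G : Type*) [TopologicalSpace G] extends ArrowGroupoid G where
  continuousOn_comp :
    ContinuousOn (fun p : G × G => comp p.1 p.2) {p | d p.1 = r p.2}
  continuous_inv : Continuous inv
  isLocalHomeomorph_r : IsLocalHomeomorph r

namespace EtaleGroupoid

open ArrowGroupoid

/-- The unit space `X`. -/
def unitSpace (G : Type*) [ArrowGroupoid G] : Set G := {x | r x = x}

/-- `γ` and `η` are composable with product `ζ`. -/
structure IsComp {G : Type*} [ArrowGroupoid G] (γ η ζ : G) : Prop where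
  composable : d γ = r η
  comp_eq : comp γ η = ζ

/-- Topological freeness: no non-empty open `V ⊆ G ∖ X` satisfies `r|_V = d|_V`. -/
def IsTopologicallyFree (G : Type*) [TopologicalSpace G] [ArrowGroupoid G] : Prop :=
  ∀ V : Set G, IsOpen V → V ⊆ (unitSpace G)ᶜ → (∀ γ ∈ V, r γ = d γ) → V = ∅

/-- Topological principality: the units with non-trivial isotropy have empty interior. -/
def IsTopologicallyPrincipal (G : Type*) [TopologicalSpace G] [ArrowGroupoid G] : Prop :=
  interior {x : G | x ∈ unitSpace G ∧ ∃ γ : G, r γ = x ∧ d γ = x ∧ γ ≠ x} = ∅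

/-- Minimality: there are no invariant open subsets of `X` other than `∅` and `X`. -/
def IsMinimalGroupoid (G : Type*) [TopologicalSpace G] [ArrowGroupoid G] : Prop :=
  ∀ U : Set G, IsOpen U → U ⊆ unitSpace G → (∀ γ : G, d γ ∈ U → r γ ∈ U) →
    U = ∅ ∨ U = unitSpace G

/-- Open bisections. -/
def IsOpenBisection {G : Type*} [TopologicalSpace G] [ArrowGroupoid G] (U : Set G) : Prop :=
  IsOpen U ∧ Set.InjOn (r : G → G) U ∧ Set.InjOn (d : G → G) U

/-- A unital inverse subsemigroup `S` of the inverse semigroup of open bisections, covering `G`. -/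
structure IsCoveringInverseSemigroup {G : Type*} [TopologicalSpace G] [ArrowGroupoid G]
    (S : Set (Set G)) : Prop where
  isOpenBisection : ∀ U ∈ S, IsOpenBisection U
  unitSpace_mem : unitSpace G ∈ S
  comp_mem : ∀ U ∈ S, ∀ V ∈ S, {ζ : G | ∃ γ ∈ U, ∃ η ∈ V, IsComp γ η ζ} ∈ S
  inv_mem : ∀ U ∈ S, inv '' U ∈ S
  covers : ⋃₀ S = Set.univ

section Basic

variable {G : Type*}

theorem r_r [ArrowGroupoid G] (γ : G) : r (r γ) = r γ := by
  have h := r_d (r γ)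
  rwa [d_r] at h

theorem isComp_inv_comp [ArrowGroupoid G] {γ η : G} (h : r η = r γ) :
    IsComp η (comp (inv η) γ) γ := by
  have h1 : d (inv η) = r γ := by rw [d_inv, h]
  refine ⟨?_, ?_⟩
  · rw [r_comp _ _ h1, r_inv]
  · rw [← comp_assoc _ _ _ (r_inv η).symm h1, comp_inv, h, r_comp_self]

variable [TopologicalSpace G] [EtaleGroupoid G]

theorem continuous_r : Continuous (r : G → G) := isLocalHomeomorph_r.continuous

theorem continuous_d : Continuous (d : G → G) := by
  have h : (d : G → G) = fun γ => r (inv γ) := by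
    funext γ
    exact (r_inv γ).symm
  rw [h]
  exact continuous_r.comp continuous_inv

theorem continuousAt_inv_comp {s : G → G} (hs : ∀ γ, r (s γ) = r γ) {γ₀ : G}
    (hc : ContinuousAt s γ₀) : ContinuousAt (fun γ => comp (inv (s γ)) γ) γ₀ := by
  have h1 : ∀ γ, (inv (s γ), γ) ∈ {p : G × G | d p.1 = r p.2} := fun γ => by
    change d (inv (s γ)) = r γ
    rw [d_inv, hs]
  have h2 := continuousOn_comp (G := G) _ (h1 γ₀)
  have h3 : Tendsto (fun γ => (inv (s γ), γ)) (𝓝 γ₀)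
      (𝓝[{p : G × G | d p.1 = r p.2}] (inv (s γ₀), γ₀)) := by
    refine tendsto_nhdsWithin_iff.2 ⟨?_, Eventually.of_forall h1⟩
    exact (continuous_inv.continuousAt.comp hc).prodMk_nhds continuousAt_id
  exact h2.tendsto.comp h3

/-- Local sections of the range map. -/
theorem exists_local_section {γ₀ η₀ : G} (h₀ : r η₀ = r γ₀) {V : Set G} (hV : IsOpen V)
    (hη : η₀ ∈ V) : ∃ W : Set G, IsOpen W ∧ η₀ ∈ W ∧ W ⊆ V ∧ ∃ s : G → G,
      (∀ γ, r (s γ) = r γ) ∧ ContinuousAt s γ₀ ∧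
      ∀ᶠ γ in 𝓝 γ₀, s γ ∈ W ∧ ∀ η ∈ W, r η = r γ → η = s γ := by
  classical
  obtain ⟨e, he, her⟩ := isLocalHomeomorph_r (G := G) η₀
  have hinj : Set.InjOn (r : G → G) (e.source ∩ V) := by
    rw [her]
    exact e.injOn.mono Set.inter_subset_left
  refine ⟨e.source ∩ V, e.open_source.inter hV, ⟨he, hη⟩, Set.inter_subset_right, ?_⟩
  set W := e.source ∩ V with hW
  have hWo : IsOpen W := e.open_source.inter hV
  have hW0 : η₀ ∈ W := ⟨he, hη⟩
  let s : G → G := fun γ => if h : ∃ η ∈ W, r η = r γ then h.choose else r γ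
  have hs1 : ∀ γ, (∃ η ∈ W, r η = r γ) → s γ ∈ W ∧ r (s γ) = r γ := by
    intro γ h
    have : s γ = h.choose := dif_pos h
    rw [this]
    exact h.choose_spec
  have hs : ∀ γ, r (s γ) = r γ := by
    intro γ
    by_cases h : ∃ η ∈ W, r η = r γ
    · exact (hs1 γ h).2
    · have : s γ = r γ := dif_neg h
      rw [this, r_r]
  have huniq : ∀ γ, ∀ η ∈ W, r η = r γ → η = s γ := fun γ η hη' hr =>
    hinj hη' (hs1 γ ⟨η, hη', hr⟩).1 (hr.trans (hs γ).symm)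
  have hev : ∀ N : Set G, IsOpen N → η₀ ∈ N → ∀ᶠ γ in 𝓝 γ₀, s γ ∈ W ∩ N := by
    intro N hN hN0
    have ho : IsOpen ((r : G → G) '' (W ∩ N)) :=
      isLocalHomeomorph_r.isOpenMap _ (hWo.inter hN)
    have hm : (r : G → G) γ₀ ∈ (r : G → G) '' (W ∩ N) := ⟨η₀, ⟨hW0, hN0⟩, h₀⟩
    filter_upwards [continuous_r.continuousAt.preimage_mem_nhds (ho.mem_nhds hm)] with γ hγ
    obtain ⟨η, hηm, hηr⟩ := hγ
    rw [← huniq γ η hηm.1 hηr]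
    exact hηm
  have hs0 : s γ₀ = η₀ := (huniq γ₀ η₀ hW0 h₀).symm
  refine ⟨s, hs, ?_, ?_⟩
  · rw [ContinuousAt, hs0, tendsto_nhds]
    intro N hN hN0
    exact (hev N hN hN0).mono fun γ h => h.2
  · exact (hev Set.univ isOpen_univ trivial).mono fun γ h => ⟨h.1, huniq γ⟩

end Basic

end EtaleGroupoid

/-! ### Line bundles and twists -/

open ArrowGroupoid EtaleGroupoid

/-- A line bundle over a space `G`: one-dimensional normed fibres `L γ` and a topology on the
total space `⊔ L γ` for which the projection is continuous and open, and for which fibrewise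
addition, scalar multiplication and the norm are continuous. (The topology on the fibrewise product
`⊔ L γ × L γ` is the one induced from the product of two copies of the total space.) -/
structure IsLineBundle (𝕜 : Type*) [RCLike 𝕜] {G : Type*} [TopologicalSpace G] (L : G → Type*)
    [∀ γ, NormedAddCommGroup (L γ)] [∀ γ, NormedSpace 𝕜 (L γ)]
    [TopologicalSpace (TotalSpace 𝕜 L)] : Prop where
  finrank_fiber : ∀ γ, Module.finrank 𝕜 (L γ) = 1
  continuous_proj : Continuous (fun z : TotalSpace 𝕜 L => z.proj)
  isOpenMap_proj : IsOpenMap (fun z : TotalSpace 𝕜 L => z.proj)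
  continuous_add : Continuous (fun p : TotalSpace (𝕜 × 𝕜) (L ×ᵇ L) =>
    (⟨p.proj, p.snd.1 + p.snd.2⟩ : TotalSpace 𝕜 L))
  continuous_smul : Continuous (fun p : 𝕜 × TotalSpace 𝕜 L =>
    (⟨p.2.proj, p.1 • p.2.snd⟩ : TotalSpace 𝕜 L))
  continuous_norm : Continuous (fun z : TotalSpace 𝕜 L => ‖z.snd‖)

/-- A twist over `G`: a line bundle with multiplication maps `L γ × L η → L (γη)`, for composable
`γ, η`, and an involution `L γ → L (γ⁻¹)`. The bundle is identified over the unit space with the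
trivial one, that is, `one x ∈ L x` is the element `(x, 1)` of `X × 𝕜`, so that `z · z* = |z|²`
makes sense. To avoid transports between equal fibres, the product of `L γ` and `L η` takes its
values in `L ζ` for each `ζ` that is equal to `γη`. -/
structure Twist (𝕜 : Type*) [RCLike 𝕜] {G : Type*} [TopologicalSpace G] [EtaleGroupoid G]
    (L : G → Type*) [∀ γ, NormedAddCommGroup (L γ)] [∀ γ, NormedSpace 𝕜 (L γ)]
    [TopologicalSpace (TotalSpace 𝕜 L)] where
  isLineBundle : IsLineBundle 𝕜 L
  /-- the multiplication -/
  mul : ∀ {γ η ζ : G}, IsComp γ η ζ → L γ →ₗ[𝕜] L η →ₗ[𝕜] L ζ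
  /-- the involution -/
  star : ∀ γ : G, L γ →ₛₗ[starRingEnd 𝕜] L (inv γ)
  /-- the unit section over the unit space -/
  one : ∀ x : G, x ∈ unitSpace G → L x
  continuous_mul : Continuous
    (fun p : {p : TotalSpace 𝕜 L × TotalSpace 𝕜 L // d p.1.proj = r p.2.proj} =>
      (⟨comp p.1.1.proj p.1.2.proj, mul ⟨p.2, rfl⟩ p.1.1.snd p.1.2.snd⟩ : TotalSpace 𝕜 L))
  continuous_star : Continuous
    (fun z : TotalSpace 𝕜 L => (⟨inv z.proj, star z.proj z.snd⟩ : TotalSpace 𝕜 L))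
  continuous_one : Continuous
    (fun x : unitSpace G => (⟨x.1, one x.1 x.2⟩ : TotalSpace 𝕜 L))
  norm_mul : ∀ {γ η ζ : G} (h : IsComp γ η ζ) (z : L γ) (w : L η), ‖mul h z w‖ = ‖z‖ * ‖w‖
  mul_assoc : ∀ {α β γ δ ε ζ : G} (h₁ : IsComp α β δ) (h₂ : IsComp δ γ ζ) (h₃ : IsComp β γ ε)
    (h₄ : IsComp α ε ζ) (x : L α) (y : L β) (z : L γ),
    mul h₂ (mul h₁ x y) z = mul h₄ x (mul h₃ y z)
  norm_star : ∀ (γ : G) (z : L γ), ‖star γ z‖ = ‖z‖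
  star_mul : ∀ {γ η ζ : G} (h : IsComp γ η ζ) (h' : IsComp (inv η) (inv γ) (inv ζ))
    (z : L γ) (w : L η), star ζ (mul h z w) = mul h' (star η w) (star γ z)
  mul_star : ∀ {γ x : G} (hx : x ∈ unitSpace G) (h : IsComp γ (inv γ) x) (z : L γ),
    mul h z (star γ z) = ((‖z‖ ^ 2 : ℝ) : 𝕜) • one x hx
  one_mul : ∀ {x γ : G} (hx : x ∈ unitSpace G) (h : IsComp x γ γ) (z : L γ),
    mul h (one x hx) z = z
  mul_one : ∀ {x γ : G} (hx : x ∈ unitSpace G) (h : IsComp γ x γ) (z : L γ),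
    mul h z (one x hx) = z

namespace Twist

variable {𝕜 : Type*} [RCLike 𝕜] {G : Type*} [TopologicalSpace G] [EtaleGroupoid G]
  {L : G → Type*} [∀ γ, NormedAddCommGroup (L γ)] [∀ γ, NormedSpace 𝕜 (L γ)]
  [TopologicalSpace (TotalSpace 𝕜 L)] (T : Twist 𝕜 L)

/-! ### Continuity of sections -/

theorem continuousAt_add (T : Twist 𝕜 L) {f g : ∀ γ, L γ} {γ₀ : G}
    (hf : ContinuousAt (fun γ => (⟨γ, f γ⟩ : TotalSpace 𝕜 L)) γ₀)
    (hg : ContinuousAt (fun γ => (⟨γ, g γ⟩ : TotalSpace 𝕜 L)) γ₀) :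
    ContinuousAt (fun γ => (⟨γ, f γ + g γ⟩ : TotalSpace 𝕜 L)) γ₀ := by
  have h : ContinuousAt
      (fun γ => (⟨γ, (f γ, g γ)⟩ : TotalSpace (𝕜 × 𝕜) (L ×ᵇ L))) γ₀ := by
    rw [(FiberBundle.Prod.isInducing_diag 𝕜 L 𝕜 L).continuousAt_iff]
    exact hf.prodMk hg
  exact T.isLineBundle.continuous_add.continuousAt.comp h

theorem continuous_zero (T : Twist 𝕜 L) :
    Continuous (fun γ => (⟨γ, 0⟩ : TotalSpace 𝕜 L)) := by
  have hq : IsQuotientMap (fun z : TotalSpace 𝕜 L => z.proj) :=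
    T.isLineBundle.isOpenMap_proj.isQuotientMap T.isLineBundle.continuous_proj
      (fun γ => ⟨⟨γ, 0⟩, rfl⟩)
  rw [hq.continuous_iff]
  have h : Continuous (fun z : TotalSpace 𝕜 L => ((0 : 𝕜), z)) := by fun_prop
  have h2 := T.isLineBundle.continuous_smul.comp h
  simpa [Function.comp_def] using h2

theorem continuousAt_sum (T : Twist 𝕜 L) {ι : Type*} (F : Finset ι) (f : ι → ∀ γ, L γ) {γ₀ : G}
    (hf : ∀ i ∈ F, ContinuousAt (fun γ => (⟨γ, f i γ⟩ : TotalSpace 𝕜 L)) γ₀) :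
    ContinuousAt (fun γ => (⟨γ, ∑ i ∈ F, f i γ⟩ : TotalSpace 𝕜 L)) γ₀ := by
  classical
  induction F using Finset.induction_on with
  | empty => simpa using T.continuous_zero.continuousAt
  | insert i F hi ih =>
    simp only [Finset.sum_insert hi]
    exact T.continuousAt_add (hf i (Finset.mem_insert_self i F))
      (ih fun j hj => hf j (Finset.mem_insert_of_mem hj))

theorem continuousAt_mul_section {f g : ∀ γ, L γ}
    (hf : Continuous (fun γ => (⟨γ, f γ⟩ : TotalSpace 𝕜 L)))
    (hg : Continuous (fun γ => (⟨γ, g γ⟩ : TotalSpace 𝕜 L)))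
    {s : G → G} (hs : ∀ γ, r (s γ) = r γ) {γ₀ : G} (hc : ContinuousAt s γ₀) :
    ContinuousAt (fun γ => (⟨γ, T.mul (isComp_inv_comp (hs γ)) (f (s γ))
      (g (comp (inv (s γ)) γ))⟩ : TotalSpace 𝕜 L)) γ₀ := by
  have hgen : ∀ {γ η ζ : G} (h : IsComp γ η ζ) (z : L γ) (w : L η),
      (⟨ζ, T.mul h z w⟩ : TotalSpace 𝕜 L) =
        ⟨comp γ η, T.mul ⟨h.composable, rfl⟩ z w⟩ := by
    rintro γ η ζ ⟨h, rfl⟩ z w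
    rfl
  have heq : (fun γ => (⟨γ, T.mul (isComp_inv_comp (hs γ)) (f (s γ))
      (g (comp (inv (s γ)) γ))⟩ : TotalSpace 𝕜 L)) =
      fun γ => ⟨comp (s γ) (comp (inv (s γ)) γ),
        T.mul ⟨(isComp_inv_comp (hs γ)).composable, rfl⟩ (f (s γ)) (g (comp (inv (s γ)) γ))⟩ :=
    funext fun γ => hgen _ _ _
  rw [heq]
  have h1 : ContinuousAt (fun γ => (⟨((⟨s γ, f (s γ)⟩ : TotalSpace 𝕜 L),
      (⟨comp (inv (s γ)) γ, g (comp (inv (s γ)) γ)⟩ : TotalSpace 𝕜 L)),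
      (isComp_inv_comp (hs γ)).composable⟩ :
      {p : TotalSpace 𝕜 L × TotalSpace 𝕜 L // d p.1.proj = r p.2.proj})) γ₀ := by
    refine tendsto_subtype_rng.2 (ContinuousAt.prodMk ?_ ?_)
    · exact ContinuousAt.comp (g := fun γ => (⟨γ, f γ⟩ : TotalSpace 𝕜 L)) hf.continuousAt hc
    · exact ContinuousAt.comp (g := fun γ => (⟨γ, g γ⟩ : TotalSpace 𝕜 L)) hg.continuousAt
        (continuousAt_inv_comp hs hc)
  exact T.continuous_mul.continuousAt.comp h1

theorem continuous_norm_section (T : Twist 𝕜 L) {f : ∀ γ, L γ}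
    (hf : Continuous (fun γ => (⟨γ, f γ⟩ : TotalSpace 𝕜 L))) : Continuous (fun γ => ‖f γ‖) :=
  T.isLineBundle.continuous_norm.comp hf

theorem continuous_add_section (T : Twist 𝕜 L) {f g : ∀ γ, L γ}
    (hf : Continuous (fun γ => (⟨γ, f γ⟩ : TotalSpace 𝕜 L)))
    (hg : Continuous (fun γ => (⟨γ, g γ⟩ : TotalSpace 𝕜 L))) :
    Continuous (fun γ => (⟨γ, f γ + g γ⟩ : TotalSpace 𝕜 L)) :=
  continuous_iff_continuousAt.2 fun _ => T.continuousAt_add hf.continuousAt hg.continuousAt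

theorem continuous_smul_section (T : Twist 𝕜 L) (c : 𝕜) {f : ∀ γ, L γ}
    (hf : Continuous (fun γ => (⟨γ, f γ⟩ : TotalSpace 𝕜 L))) :
    Continuous (fun γ => (⟨γ, c • f γ⟩ : TotalSpace 𝕜 L)) :=
  T.isLineBundle.continuous_smul.comp (continuous_const.prodMk hf)

/-! ### Spaces of sections and convolution -/

/-- `C_c(G, L)`: continuous compactly supported sections. -/
def Cc : Submodule 𝕜 (∀ γ, L γ) where
  carrier := {f | Continuous (fun γ => (⟨γ, f γ⟩ : TotalSpace 𝕜 L)) ∧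
    HasCompactSupport (fun γ => ‖f γ‖)}
  zero_mem' := ⟨T.continuous_zero, by
    have h : (fun γ => ‖(0 : ∀ γ, L γ) γ‖) = (0 : G → ℝ) := by
      funext γ
      simp
    change HasCompactSupport (fun γ => ‖(0 : ∀ γ, L γ) γ‖)
    rw [h]
    exact HasCompactSupport.zero⟩
  add_mem' := by
    rintro f g ⟨hf, hf'⟩ ⟨hg, hg'⟩
    refine ⟨T.continuous_add_section hf hg, (hf'.add hg').mono ?_⟩
    intro γ hγ h0
    have h1 : ‖f γ‖ + ‖g γ‖ = 0 := h0
    have h2 := norm_add_le (f γ) (g γ)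
    rw [h1] at h2
    exact hγ (le_antisymm h2 (norm_nonneg _))
  smul_mem' := by
    rintro c f ⟨hf, hf'⟩
    refine ⟨T.continuous_smul_section c hf, hf'.mono ?_⟩
    intro γ hγ h0
    refine hγ ?_
    have h1 : ‖f γ‖ = 0 := h0
    change ‖c • f γ‖ = 0
    rw [norm_smul, h1, mul_zero]

/-- `C_0(G, L)`: continuous sections vanishing at infinity. -/
def C0 : Submodule 𝕜 (∀ γ, L γ) where
  carrier := {f | Continuous (fun γ => (⟨γ, f γ⟩ : TotalSpace 𝕜 L)) ∧
    ∀ ε : ℝ, 0 < ε → IsCompact {γ | ε ≤ ‖f γ‖}}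
  zero_mem' := ⟨T.continuous_zero, fun ε hε => by
    have h : {γ : G | ε ≤ ‖(0 : ∀ γ, L γ) γ‖} = ∅ := by
      ext γ
      simpa using hε
    rw [h]
    exact isCompact_empty⟩
  add_mem' := by
    rintro f g ⟨hf, hf'⟩ ⟨hg, hg'⟩
    have hc := T.continuous_add_section hf hg
    refine ⟨hc, fun ε hε => ?_⟩
    refine ((hf' (ε / 2) (half_pos hε)).union (hg' (ε / 2) (half_pos hε))).of_isClosed_subset
      (isClosed_le continuous_const (T.continuous_norm_section hc)) ?_
    intro γ hγ
    have h1 : ε ≤ ‖f γ + g γ‖ := hγ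
    have h2 := norm_add_le (f γ) (g γ)
    by_contra hcon
    rw [Set.mem_union, not_or] at hcon
    have h3 : ‖f γ‖ < ε / 2 := not_le.1 hcon.1
    have h4 : ‖g γ‖ < ε / 2 := not_le.1 hcon.2
    linarith
  smul_mem' := by
    rintro c f ⟨hf, hf'⟩
    refine ⟨T.continuous_smul_section c hf, fun ε hε => ?_⟩
    by_cases hc : c = 0
    · have h : {γ : G | ε ≤ ‖(c • f) γ‖} = ∅ := by
        ext γ
        simpa [hc] using hε
      rw [h]
      exact isCompact_empty
    · have hc' : 0 < ‖c‖ := norm_pos_iff.2 hc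
      have h : {γ : G | ε ≤ ‖(c • f) γ‖} = {γ | ε / ‖c‖ ≤ ‖f γ‖} := by
        ext γ
        simp [norm_smul, div_le_iff₀ hc', mul_comm]
      rw [h]
      exact hf' _ (div_pos hε hc')

/-- Convolution `(f * g)(γ) = ∑_{r(η) = r(γ)} f(η) · g(η⁻¹γ)`; the sum has finitely many non-zero
terms if `f` or `g` has compact support. -/
noncomputable def conv (f g : ∀ γ, L γ) (γ : G) : L γ :=
  ∑ᶠ η : {η : G // r η = r γ},
    T.mul (isComp_inv_comp η.2) (f η.1) (g (comp (inv η.1) γ))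

theorem continuousAt_conv [T2Space G] {f g : ∀ γ, L γ} (hf : f ∈ T.Cc) (hg : g ∈ T.Cc) (γ₀ : G) :
    ContinuousAt (fun γ => (⟨γ, T.conv f g γ⟩ : TotalSpace 𝕜 L)) γ₀ := by
  classical
  have hK : IsCompact (tsupport fun γ => ‖f γ‖) := hf.2
  set K : Set G := tsupport fun γ => ‖f γ‖ with hKdef
  have hfK : ∀ η, f η ≠ 0 → η ∈ K := fun η hη => subset_tsupport _ (by simpa using hη)
  have hAc : IsCompact (K ∩ {η | r η = r γ₀}) :=
    hK.inter_right (isClosed_eq continuous_r continuous_const)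
  have hAfin : (K ∩ {η : G | r η = r γ₀}).Finite := by
    have hloc : ∀ η : G, ∃ W : Set G, IsOpen W ∧ η ∈ W ∧ Set.InjOn (r : G → G) W := by
      intro η
      obtain ⟨e, he, her⟩ := isLocalHomeomorph_r (G := G) η
      exact ⟨e.source, e.open_source, he, by rw [her]; exact e.injOn⟩
    choose W hWo hWm hWi using hloc
    obtain ⟨t, -, ht⟩ := hAc.elim_nhds_subcover W (fun η _ => (hWo η).mem_nhds (hWm η))
    have hsub : K ∩ {η : G | r η = r γ₀} ⊆ ⋃ x ∈ t, W x ∩ {η : G | r η = r γ₀} := by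
      intro η hη
      obtain ⟨x, hx, hxW⟩ := Set.mem_iUnion₂.1 (ht hη)
      exact Set.mem_iUnion₂.2 ⟨x, hx, hxW, hη.2⟩
    refine Set.Finite.subset (t.finite_toSet.biUnion fun x _ => ?_) hsub
    refine Set.Subsingleton.finite fun a ha b hb => hWi x ha.1 hb.1 (ha.2.trans hb.2.symm)
  obtain ⟨U, hU, hUd⟩ := hAfin.t2_separation
  have hloc : ∀ η : G, ∃ W : Set G, η ∈ K ∩ {η | r η = r γ₀} →
      IsOpen W ∧ η ∈ W ∧ W ⊆ U η ∧ ∃ s : G → G,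
      (∀ γ, r (s γ) = r γ) ∧ ContinuousAt s γ₀ ∧
      ∀ᶠ γ in 𝓝 γ₀, s γ ∈ W ∧ ∀ η ∈ W, r η = r γ → η = s γ := by
    intro η
    by_cases hη : η ∈ K ∩ {η | r η = r γ₀}
    · obtain ⟨W, hW⟩ := exists_local_section (γ₀ := γ₀) hη.2 (hU η).2 (hU η).1
      exact ⟨W, fun _ => hW⟩
    · exact ⟨∅, fun h => absurd h hη⟩
  choose W hW using hloc
  have hsec : ∀ η : G, ∃ s : G → G, (∀ γ, r (s γ) = r γ) ∧
      (η ∈ K ∩ {η | r η = r γ₀} → ContinuousAt s γ₀ ∧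
      ∀ᶠ γ in 𝓝 γ₀, s γ ∈ W η ∧ ∀ η' ∈ W η, r η' = r γ → η' = s γ) := by
    intro η
    by_cases hη : η ∈ K ∩ {η | r η = r γ₀}
    · obtain ⟨-, -, -, s, hs1, hs2, hs3⟩ := hW η hη
      exact ⟨s, hs1, fun _ => ⟨hs2, hs3⟩⟩
    · exact ⟨r, r_r, fun h => absurd h hη⟩
  choose s hs hs' using hsec
  set F : Finset G := hAfin.toFinset with hF
  have hmemF : ∀ η, η ∈ F ↔ η ∈ K ∩ {η | r η = r γ₀} := fun η => hAfin.mem_toFinset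
  let t : G → ∀ γ, L γ := fun η γ =>
    T.mul (isComp_inv_comp (hs η γ)) (f (s η γ)) (g (comp (inv (s η γ)) γ))
  have hsum : ContinuousAt (fun γ => (⟨γ, ∑ η ∈ F, t η γ⟩ : TotalSpace 𝕜 L)) γ₀ :=
    T.continuousAt_sum F t fun η hη =>
      T.continuousAt_mul_section hf.1 hg.1 (hs η) (hs' η ((hmemF η).1 hη)).1
  refine hsum.congr ?_
  have hWF : ∀ᶠ γ in 𝓝 γ₀, ∀ η ∈ F, s η γ ∈ W η ∧ ∀ η' ∈ W η, r η' = r γ → η' = s η γ := by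
    rw [Filter.eventually_all_finset]
    exact fun η hη => (hs' η ((hmemF η).1 hη)).2
  have hcov : ∀ᶠ γ in 𝓝 γ₀, ∀ η ∈ K, r η = r γ → ∃ x ∈ F, η ∈ W x := by
    have hcpt : IsCompact ((r : G → G) '' (K \ ⋃ x ∈ F, W x)) := by
      refine (hK.diff ?_).image continuous_r
      exact isOpen_biUnion fun x hx => (hW x ((hmemF x).1 hx)).1
    have hnot : (r : G → G) γ₀ ∉ (r : G → G) '' (K \ ⋃ x ∈ F, W x) := by
      rintro ⟨η, ⟨hηK, hηW⟩, hηr⟩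
      have hηF : η ∈ K ∩ {η | r η = r γ₀} := ⟨hηK, hηr⟩
      exact hηW (Set.mem_iUnion₂.2 ⟨η, (hmemF η).2 hηF, (hW η hηF).2.1⟩)
    have hnhds := continuous_r.continuousAt.preimage_mem_nhds
      (hcpt.isClosed.isOpen_compl.mem_nhds hnot)
    filter_upwards [hnhds] with γ hγ η hηK hηr
    by_contra hcon
    refine hγ ⟨η, ⟨hηK, fun hmem => hcon ?_⟩, hηr⟩
    obtain ⟨x, hx, hxW⟩ := Set.mem_iUnion₂.1 hmem
    exact ⟨x, hx, hxW⟩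
  filter_upwards [hWF, hcov] with γ h1 h2
  congr 1
  symm
  have hinj : Set.InjOn (fun η => (⟨s η γ, hs η γ⟩ : {η : G // r η = r γ})) (F : Set G) := by
    intro a ha b hb hab
    by_contra hne
    have hab' : s a γ = s b γ := congrArg Subtype.val hab
    have ha' := (hmemF a).1 ha
    have hb' := (hmemF b).1 hb
    have hdis := hUd ha' hb' hne
    refine Set.disjoint_left.1 hdis ((hW a ha').2.2.1 (h1 a ha).1) ?_
    rw [hab']
    exact (hW b hb').2.2.1 (h1 b hb).1
  rw [conv, finsum_eq_sum_of_support_subset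
    (s := F.image (fun η => (⟨s η γ, hs η γ⟩ : {η : G // r η = r γ}))),
    Finset.sum_image hinj]
  intro η hη
  have hfη : f η.1 ≠ 0 := by
    intro h0
    apply hη
    simp [h0]
  obtain ⟨x, hx, hxW⟩ := h2 η.1 (hfK _ hfη) η.2
  rw [Finset.coe_image]
  exact ⟨x, hx, Subtype.ext ((h1 x hx).2 η.1 hxW η.2).symm⟩

theorem conv_mem_Cc [T2Space G] {f g : ∀ γ, L γ} (hf : f ∈ T.Cc) (hg : g ∈ T.Cc) :
    T.conv f g ∈ T.Cc := by
  refine ⟨continuous_iff_continuousAt.2 fun γ₀ => T.continuousAt_conv hf hg γ₀, ?_⟩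
  have hcl : IsClosed {p : G × G | d p.1 = r p.2} :=
    isClosed_eq (continuous_d.comp continuous_fst) (continuous_r.comp continuous_snd)
  have hK : IsCompact (((tsupport fun γ => ‖f γ‖) ×ˢ (tsupport fun γ => ‖g γ‖)) ∩
      {p : G × G | d p.1 = r p.2}) :=
    (IsCompact.prod hf.2 hg.2).inter_right hcl
  have hK2 := hK.image_of_continuousOn
    ((continuousOn_comp (G := G)).mono Set.inter_subset_right)
  refine HasCompactSupport.of_support_subset_isCompact hK2 ?_
  intro γ hγ
  have h0 : T.conv f g γ ≠ 0 := by simpa using hγ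
  obtain ⟨η, hη⟩ : ∃ η : {η : G // r η = r γ},
      T.mul (isComp_inv_comp η.2) (f η.1) (g (comp (inv η.1) γ)) ≠ 0 := by
    by_contra hcon
    push Not at hcon
    apply h0
    rw [conv]
    simp [hcon]
  have hc := isComp_inv_comp η.2
  refine ⟨(η.1, comp (inv η.1) γ), ⟨⟨?_, ?_⟩, hc.composable⟩, hc.comp_eq⟩
  · refine subset_tsupport _ ?_
    intro h
    apply hη
    have : f η.1 = 0 := norm_eq_zero.1 h
    simp [this]
  · refine subset_tsupport _ ?_
    intro h
    apply hη
    have : g (comp (inv η.1) γ) = 0 := norm_eq_zero.1 h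
    simp [this]

/-- The convolution product of `C_c(G, L)`. -/
noncomputable instance [T2Space G] : Mul T.Cc :=
  ⟨fun f g => ⟨T.conv f g, T.conv_mem_Cc f.2 g.2⟩⟩

variable {T}

/-- `f` belongs to `C_c(U, L) ⊆ C_c(G, L)`, for `U` open: its compact support lies in `U`. -/
def SupportedIn (f : T.Cc) (U : Set G) : Prop := tsupport (fun γ => ‖f.1 γ‖) ⊆ U

/-- The supremum norm on `C_c(G, L)`. -/
noncomputable def supNorm (f : T.Cc) : ℝ := ⨆ γ, ‖f.1 γ‖

/-! ### Completions of the convolution algebra -/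

section Algebras

variable {B : Type*} [NonUnitalNormedRing B] [NormedSpace 𝕜 B]

/-- The Banach algebra `B` is, through `i`, the Hausdorff completion of `C_c(G, L)` in the
submultiplicative seminorm `f ↦ ‖i f‖`. -/
structure IsBanachCompletion [T2Space G] (i : T.Cc →ₗ[𝕜] B) : Prop where
  completeSpace : CompleteSpace B
  map_mul : ∀ f g : T.Cc, i (f * g) = i f * i g
  denseRange : DenseRange i

/-- The completion is `S`-graded: its seminorm is at most the supremum norm on `C_c(U, L)` for
each `U ∈ S`, equivalently, it is at most the maximal such seminorm
`inf {∑ ‖f_k‖_∞ : f = ∑ f_k, f_k ∈ C_c(U_k, L), U_k ∈ S}`. -/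
def IsGradedBy (S : Set (Set G)) (i : T.Cc →ₗ[𝕜] B) : Prop :=
  ∀ U ∈ S, ∀ f : T.Cc, SupportedIn f U → ‖i f‖ ≤ supNorm f

/-- The completion is reduced: it is isometric on `C_c(X)`, hence contains `C_0(X)`, and the
inclusion of `C_c(G, L)` in `C_0(G, L)` extends to an injective contraction `j`. -/
structure IsReduced (i : T.Cc →ₗ[𝕜] B) : Prop where
  isometric_unitSpace : ∀ f : T.Cc, SupportedIn f (unitSpace G) → ‖i f‖ = supNorm f
  exists_jmap : ∃ j : B →ₗ[𝕜] T.C0, (∀ b γ, ‖(j b).1 γ‖ ≤ ‖b‖) ∧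
    (∀ f : T.Cc, (j (i f)).1 = f.1) ∧ Function.Injective j

/-- The subalgebra `C_0(X)` of a reduced completion: the closure of the image of `C_c(X)`. -/
def diagonal (i : T.Cc →ₗ[𝕜] B) : Set B :=
  closure (i '' {f | SupportedIn f (unitSpace G)})

/-- For `p ∈ [1, ∞]`, the norm `‖f‖_{L^p,red}` of the operator `ξ ↦ f * ξ` on the space
`ℓ^p(G, L)` of `p`-summable (bounded, if `p = ∞`) sections: the least `C` such that
`‖f * ξ‖_p ≤ C ‖ξ‖_p` for all `ξ`. -/
noncomputable def reducedLpNorm (p : ℝ≥0∞) (f : T.Cc) : ℝ≥0∞ :=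
  sInf {C : ℝ≥0∞ | ∀ ξ : lp L p, ∃ h : Memℓp (T.conv f.1 ξ) p,
    ENNReal.ofReal ‖(⟨T.conv f.1 ξ, h⟩ : lp L p)‖ ≤ C * ENNReal.ofReal ‖ξ‖}

/-- `B` is, through `i`, the reduced `L^P`-operator algebra: the completion of `C_c(G, L)` in the
norm `‖f‖_{L^P,red} = sup_{p ∈ P} ‖f‖_{L^p,red}`. -/
structure IsReducedLpAlgebra [T2Space G] (P : Set ℝ≥0∞) (i : T.Cc →ₗ[𝕜] B) : Prop
    extends IsBanachCompletion i where
  norm_eq : ∀ f : T.Cc, ENNReal.ofReal ‖i f‖ = ⨆ p ∈ P, reducedLpNorm p f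

end Algebras

end Twist

/-! ### Banach algebras -/

/-- Simplicity of a Banach algebra: the only closed two-sided ideals are `0` and the algebra. -/
def IsSimpleBanachAlgebra (𝕜 B : Type*) [RCLike 𝕜] [NonUnitalNormedRing B] [NormedSpace 𝕜 B] :
    Prop :=
  ∀ I : Submodule 𝕜 B, IsClosed (I : Set B) → (∀ a : B, ∀ b ∈ I, a * b ∈ I ∧ b * a ∈ I) →
    I = ⊥ ∨ I = ⊤

/-- `A` is a maximal abelian subalgebra of `B`: a commutative subalgebra that is maximal among the
commutative subalgebras. -/
def IsMaximalAbelian (𝕜 : Type*) {B : Type*} [RCLike 𝕜] [NonUnitalNormedRing B]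
    [NormedSpace 𝕜 B] (A : Set B) : Prop :=
  Maximal (fun A' : Set B => (∃ D : NonUnitalSubalgebra 𝕜 B, (D : Set B) = A') ∧
    ∀ a ∈ A', ∀ b ∈ A', a * b = b * a) A

/-! ### The topology of a line bundle -/

namespace IsLineBundle

variable {𝕜 : Type*} [RCLike 𝕜] {G : Type*} [TopologicalSpace G] {L : G → Type*}
  [∀ γ, NormedAddCommGroup (L γ)] [∀ γ, NormedSpace 𝕜 (L γ)]
  [TopologicalSpace (TotalSpace 𝕜 L)]

/-! A reduced completion `B` embeds through `j` in `C_0(G, L)`. Its elements are therefore sections,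
and multiplication by an element of `C_c(G, L)` is still given by the convolution formula
(`IsInclusion.apply_mul_left`, `IsInclusion.apply_mul_right`).

(b) ⇒ (a). If `b` commutes with `C_c(X)`, the section `j b` vanishes at arrows with `r γ ≠ d γ`. The
set where it does not vanish is open, so topological freeness confines it to `X`, and
`IsInclusion.mem_diagonal` puts `b` in the closure of `C_c(X)`. For simplicity, take a non-zero
closed ideal and translate one of its elements until it is non-zero at some unit, then approximate
it by `a ∈ C_c(G, L)`. The support of `a` minus `X` is compact, so some unit `y` at which `a` is
still large is fixed by none of its arrows (`exists_no_isotropy`). Cutting `a` down near `y` on both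
sides leaves a function on `X` close to the ideal, and a Neumann series argument
(`Submodule.mem_of_sub_mul_mem`) turns this into a non-zero function on `X` inside the ideal.
Minimality spreads such functions over all of `X`, where they act as local units for `C_c(G, L)`.

(a) ⇒ (b). A section supported on an open set of non-unit isotropy arrows commutes with `C_0(X)`
without lying in it. An invariant open `U ⊆ X` gives the closed ideal of elements supported on
arrows with range in `U`.

For the `L^P`-algebras it remains to see that they are reduced (`IsReducedLpAlgebra.isReduced`).
Injectivity of `j` comes from lower semicontinuity of the operator norms under pointwise limits.
Topological principality implies topological freeness.

Local triviality is not part of the definition of a line bundle, so non-vanishing sections must be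
produced first. They come from averaging a bump function on the total space over the scalars of
modulus one (`exists_section`). -/

theorem exists_smul_eq (hL : IsLineBundle 𝕜 L) {γ : G} {v : L γ} (hv : v ≠ 0) (w : L γ) :
    ∃ c : 𝕜, c • v = w :=
  (finrank_eq_one_iff_of_nonzero' v hv).1 (hL.finrank_fiber γ) w

theorem exists_norm_eq_one (hL : IsLineBundle 𝕜 L) (γ : G) : ∃ v : L γ, ‖v‖ = 1 := by
  obtain ⟨v, hv⟩ : ∃ v : L γ, v ≠ 0 := by
    have : Nontrivial (L γ) := Module.nontrivial_of_finrank_pos (R := 𝕜) (by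
      rw [hL.finrank_fiber]; exact one_pos)
    exact exists_ne 0
  have hv' : ‖v‖ ≠ 0 := norm_ne_zero_iff.2 hv
  refine ⟨((‖v‖⁻¹ : ℝ) : 𝕜) • v, ?_⟩
  rw [norm_smul, RCLike.norm_ofReal, abs_of_nonneg (inv_nonneg.2 (norm_nonneg v)),
    inv_mul_cancel₀ hv']

theorem tendsto_smul (hL : IsLineBundle 𝕜 L) {ι : Type*} {F : Filter ι} {c : ι → 𝕜} {c₀ : 𝕜}
    {z : ι → TotalSpace 𝕜 L} {z₀ : TotalSpace 𝕜 L} (hc : Tendsto c F (𝓝 c₀))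
    (hz : Tendsto z F (𝓝 z₀)) :
    Tendsto (fun i => (⟨(z i).proj, c i • (z i).snd⟩ : TotalSpace 𝕜 L)) F
      (𝓝 ⟨z₀.proj, c₀ • z₀.snd⟩) :=
  (hL.continuous_smul.tendsto (c₀, z₀)).comp (hc.prodMk_nhds hz)

theorem tendsto_norm_sub (hL : IsLineBundle 𝕜 L) {ι : Type*} {F : Filter ι} {s : ι → G}
    {a b : ∀ i, L (s i)} {γ : G} {v w : L γ}
    (ha : Tendsto (fun i => (⟨s i, a i⟩ : TotalSpace 𝕜 L)) F (𝓝 ⟨γ, v⟩))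
    (hb : Tendsto (fun i => (⟨s i, b i⟩ : TotalSpace 𝕜 L)) F (𝓝 ⟨γ, w⟩)) :
    Tendsto (fun i => ‖a i - b i‖) F (𝓝 ‖v - w‖) := by
  have hb' := hL.tendsto_smul (tendsto_const_nhds (x := (-1 : 𝕜))) hb
  have h : Tendsto (fun i => (⟨s i, (a i, (-1 : 𝕜) • b i)⟩ : TotalSpace (𝕜 × 𝕜) (L ×ᵇ L))) F
      (𝓝 ⟨γ, (v, (-1 : 𝕜) • w)⟩) := by
    rw [(FiberBundle.Prod.isInducing_diag 𝕜 L 𝕜 L).tendsto_nhds_iff]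
    exact ha.prodMk_nhds hb'
  have h2 := ((hL.continuous_norm.comp hL.continuous_add).tendsto _).comp h
  simpa [Function.comp_def, sub_eq_add_neg] using h2

/-- If the neighbourhood filters of two points meet, the points lie over the same `γ`. Along the
common filter the difference `z - z = 0` has norm tending to `‖v - w‖`, so the points agree. -/
theorem t2Space (hL : IsLineBundle 𝕜 L) [T2Space G] : T2Space (TotalSpace 𝕜 L) := by
  rw [t2_iff_nhds]
  intro x y hne
  have hx : Tendsto (fun z : TotalSpace 𝕜 L => z) (𝓝 x ⊓ 𝓝 y) (𝓝 x) :=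
    tendsto_id.mono_left inf_le_left
  have hy : Tendsto (fun z : TotalSpace 𝕜 L => z) (𝓝 x ⊓ 𝓝 y) (𝓝 y) :=
    tendsto_id.mono_left inf_le_right
  have hp : x.proj = y.proj := tendsto_nhds_unique
    ((hL.continuous_proj.tendsto x).comp hx) ((hL.continuous_proj.tendsto y).comp hy)
  obtain ⟨γ, v⟩ := x
  obtain ⟨γ', w⟩ := y
  obtain rfl : γ = γ' := hp
  have h := hL.tendsto_norm_sub (s := fun z : TotalSpace 𝕜 L => z.proj) (a := fun z => z.snd)
    (b := fun z => z.snd) hx hy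
  simp only [sub_self, norm_zero] at h
  have h0 := tendsto_nhds_unique h tendsto_const_nhds
  rw [sub_eq_zero.1 (norm_eq_zero.1 h0)]

/-- Openness of the projection replaces local triviality: vectors over arrows near `γ` are scalar
multiples of vectors near a fixed unit vector `v` over `γ`, with scalars in a fixed ball. An
ultrafilter of bounded vectors thus lifts to pairs (scalar, vector near `v`), and compactness of the
ball gives the limit `t • v`. -/
theorem isCompact_norm_le (hL : IsLineBundle 𝕜 L) {C : Set G} (hC : IsCompact C) (R : ℝ) :
    IsCompact {z : TotalSpace 𝕜 L | z.proj ∈ C ∧ ‖z.snd‖ ≤ R} := by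
  rw [isCompact_iff_ultrafilter_le_nhds]
  intro u hu
  rw [le_principal_iff] at hu
  have huC : map (fun z : TotalSpace 𝕜 L => z.proj) u ≤ 𝓟 C := by
    rw [le_principal_iff]
    exact mem_map.2 (mem_of_superset hu fun z hz => hz.1)
  obtain ⟨γ, hγ, hγu⟩ := isCompact_iff_ultrafilter_le_nhds.1 hC (u.map _) huC
  obtain ⟨v, hv⟩ := hL.exists_norm_eq_one γ
  let m : 𝕜 × TotalSpace 𝕜 L → TotalSpace 𝕜 L := fun p => ⟨p.2.proj, p.1 • p.2.snd⟩
  let B : Set 𝕜 := Metric.closedBall 0 (2 * max R 0)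
  -- pairs `(t, w)` with `w` close to `v` and `t • w` in the ultrafilter
  let 𝓕 : Filter (𝕜 × TotalSpace 𝕜 L) := (𝓟 B ×ˢ 𝓝 ⟨γ, v⟩) ⊓ comap m u
  have hne : 𝓕.NeBot := by
    rw [inf_neBot_iff]
    rintro s hs s' ⟨A, hA, hAs⟩
    obtain ⟨s₁, hs₁, N, hN, hsN⟩ := mem_prod_iff.1 hs
    have hN' : N ∩ {z : TotalSpace 𝕜 L | 1 / 2 < ‖z.snd‖} ∈ 𝓝 (⟨γ, v⟩ : TotalSpace 𝕜 L) := by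
      refine inter_mem hN ((isOpen_lt continuous_const hL.continuous_norm).mem_nhds ?_)
      change (1 : ℝ) / 2 < ‖v‖
      rw [hv]; norm_num
    have h1 : (fun z : TotalSpace 𝕜 L => z.proj) '' (N ∩ {z : TotalSpace 𝕜 L | 1 / 2 < ‖z.snd‖})
        ∈ 𝓝 γ := hL.isOpenMap_proj.image_mem_nhds hN'
    obtain ⟨⟨η, w⟩, ⟨⟨hwA, -, hwR⟩, ⟨η', w'⟩, ⟨hw'N, hw'⟩, hηη'⟩⟩ :=
      u.neBot.nonempty_of_mem (inter_mem (inter_mem hA hu) (hγu h1))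
    obtain rfl : η' = η := hηη'
    change 1 / 2 < ‖w'‖ at hw'
    change ‖w‖ ≤ R at hwR
    have hw'0 : w' ≠ 0 := by
      rintro rfl
      rw [norm_zero] at hw'
      norm_num at hw'
    obtain ⟨t, ht⟩ := hL.exists_smul_eq hw'0 w
    refine ⟨(t, ⟨η', w'⟩), hsN ⟨hs₁ ?_, hw'N⟩, hAs ?_⟩
    · simp only [B, mem_closedBall_zero_iff]
      have h2 : ‖t‖ * ‖w'‖ = ‖w‖ := by rw [← ht, norm_smul]
      have h3 : ‖t‖ * ‖w'‖ ≤ max R 0 := h2.le.trans (hwR.trans (le_max_left _ _))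
      nlinarith [norm_nonneg t]
    · change (⟨η', t • w'⟩ : TotalSpace 𝕜 L) ∈ A
      rw [ht]
      exact hwA
  let u' : Ultrafilter (𝕜 × TotalSpace 𝕜 L) := Ultrafilter.of 𝓕
  have hu' : (u' : Filter _) ≤ 𝓕 := Ultrafilter.of_le 𝓕
  have hu1 : Tendsto (Prod.fst : 𝕜 × TotalSpace 𝕜 L → 𝕜) (u' : Filter _) (𝓟 B) :=
    tendsto_fst.mono_left (hu'.trans inf_le_left)
  have hu2 : Tendsto (Prod.snd : 𝕜 × TotalSpace 𝕜 L → _) (u' : Filter _)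
      (𝓝 (⟨γ, v⟩ : TotalSpace 𝕜 L)) :=
    tendsto_snd.mono_left (hu'.trans inf_le_left)
  have hum : Tendsto m (u' : Filter _) u := tendsto_comap.mono_left (hu'.trans inf_le_right)
  obtain ⟨t, -, ht⟩ := isCompact_iff_ultrafilter_le_nhds.1
    (isCompact_closedBall (0 : 𝕜) (2 * max R 0)) (u'.map Prod.fst) hu1
  have hlim : Tendsto m (u' : Filter _) (𝓝 ⟨γ, t • v⟩) := hL.tendsto_smul ht hu2
  have hu_eq : u'.map m = u := Ultrafilter.coe_le_coe.1 hum
  have hle : (u : Filter _) ≤ 𝓝 (⟨γ, t • v⟩ : TotalSpace 𝕜 L) := by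
    rw [← hu_eq]
    exact hlim
  refine ⟨⟨γ, t • v⟩, ⟨hγ, ?_⟩, hle⟩
  exact le_of_tendsto ((hL.continuous_norm.tendsto _).mono_left hle)
    (mem_of_superset hu fun z hz => hz.2)

theorem locallyCompactSpace (hL : IsLineBundle 𝕜 L) [T2Space G] [LocallyCompactSpace G] :
    LocallyCompactSpace (TotalSpace 𝕜 L) := by
  have := hL.t2Space
  have : WeaklyLocallyCompactSpace (TotalSpace 𝕜 L) := by
    refine ⟨fun z => ?_⟩
    obtain ⟨C, hC, hCz⟩ := exists_compact_mem_nhds z.proj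
    refine ⟨_, hL.isCompact_norm_le hC (‖z.snd‖ + 1), ?_⟩
    filter_upwards [hL.continuous_proj.continuousAt.preimage_mem_nhds hCz,
      (isOpen_lt hL.continuous_norm continuous_const).mem_nhds (lt_add_one ‖z.snd‖)] with w h1 h2
    exact ⟨h1, le_of_lt h2⟩
  infer_instance

/-- A continuous function on the total space that is equivariant under scalars of modulus one and
does not vanish at a given point. -/
theorem exists_equivariant (hL : IsLineBundle 𝕜 L) [T2Space G] [LocallyCompactSpace G]
    {γ₀ : G} {v₀ : L γ₀} (hv₀ : v₀ ≠ 0) :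
    ∃ F : TotalSpace 𝕜 L → 𝕜, Continuous F ∧ F ⟨γ₀, v₀⟩ ≠ 0 ∧
      ∀ (t : 𝕜) (z : TotalSpace 𝕜 L), ‖t‖ = 1 → F ⟨z.proj, t • z.snd⟩ = t * F z := by
  have := hL.t2Space
  have := hL.locallyCompactSpace
  let K := Metric.sphere (0 : 𝕜) 1
  let act : K → TotalSpace 𝕜 L → TotalSpace 𝕜 L := fun t z => ⟨z.proj, (t : 𝕜) • z.snd⟩
  have hact : Continuous fun p : K × TotalSpace 𝕜 L => act p.1 p.2 :=
    hL.continuous_smul.comp ((continuous_subtype_val.comp continuous_fst).prodMk continuous_snd)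
  have hact_mul : ∀ s t z, act s (act t z) = act (s * t) z := fun s t z => by
    simp only [act, smul_smul]
    rfl
  let z₀ : TotalSpace 𝕜 L := ⟨γ₀, v₀⟩
  -- a bump function at `z₀` that vanishes on the part of the orbit far from `z₀`
  have hC : IsCompact ((fun t : K => act t z₀) '' {t : K | RCLike.re (t : 𝕜) ≤ 1 / 2}) := by
    refine IsCompact.image ?_ (hact.comp (continuous_id.prodMk continuous_const))
    exact (isClosed_le (RCLike.continuous_re.comp continuous_subtype_val)
      continuous_const).isCompact
  have hdisj : Disjoint {z₀} ((fun t : K => act t z₀) '' {t : K | RCLike.re (t : 𝕜) ≤ 1 / 2}) := by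
    rw [Set.disjoint_singleton_left]
    rintro ⟨t, ht, htz⟩
    have h1 : (t : 𝕜) • v₀ = v₀ := by
      have := TotalSpace.mk_inj.1 htz
      exact this
    have h2 : (t : 𝕜) = 1 := by
      rw [← sub_eq_zero]
      refine (smul_eq_zero.1 (?_ : ((t : 𝕜) - 1) • v₀ = 0)).resolve_right hv₀
      rw [sub_smul, h1, one_smul, sub_self]
    change RCLike.re (t : 𝕜) ≤ 1 / 2 at ht
    rw [h2, RCLike.one_re] at ht
    norm_num at ht
  obtain ⟨f, hf1, hf0, -, hf⟩ :=
    exists_continuous_one_zero_of_isCompact isCompact_singleton hC.isClosed hdisj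
  let μ : MeasureTheory.Measure K := MeasureTheory.Measure.haar
  -- Integrating `f (t⁻¹ z) t` over the compact group `K` projects `f` to the functions that
  -- transform by the identity character; invariance of Haar measure gives the equivariance.
  let φ : TotalSpace 𝕜 L → K → 𝕜 := fun z t => ((f (act t⁻¹ z) : ℝ) : 𝕜) * (t : 𝕜)
  have hφ : Continuous fun p : TotalSpace 𝕜 L × K => φ p.1 p.2 := by
    refine Continuous.mul (RCLike.continuous_ofReal.comp (f.continuous.comp ?_))
      (continuous_subtype_val.comp continuous_snd)
    exact hact.comp (continuous_snd.inv.prodMk continuous_fst)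
  have hφz : ∀ z, Continuous (φ z) := fun z => hφ.comp (continuous_const.prodMk continuous_id)
  have hint : ∀ z, MeasureTheory.Integrable (φ z) μ := fun z =>
    (hφz z).integrable_of_hasCompactSupport (HasCompactSupport.of_compactSpace _)
  refine ⟨fun z => ∫ t, φ z t ∂μ, ?_, ?_, ?_⟩
  · let Φ : TotalSpace 𝕜 L → C(K, 𝕜) := fun z => ⟨φ z, hφz z⟩
    have hΦ : Continuous Φ := ContinuousMap.continuous_of_continuous_uncurry _ hφ
    refine continuous_iff_continuousAt.2 fun z => ?_
    rw [ContinuousAt, tendsto_iff_norm_sub_tendsto_zero]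
    have h1 : Tendsto (fun w => ‖Φ w - Φ z‖ * μ.real Set.univ) (𝓝 z) (𝓝 0) := by
      have := ((tendsto_iff_norm_sub_tendsto_zero.1 (hΦ.tendsto z)).mul_const (μ.real Set.univ))
      simpa using this
    refine squeeze_zero (fun _ => norm_nonneg _) (fun w => ?_) h1
    rw [← MeasureTheory.integral_sub (hint w) (hint z)]
    exact MeasureTheory.norm_integral_le_of_norm_le_const
      (Eventually.of_forall fun t => (Φ w - Φ z).norm_coe_le_norm t)
  -- Where `Re t ≤ 1/2` the factor `f (t⁻¹ z₀)` vanishes, because `t⁻¹` is the conjugate of `t` and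
  -- has the same real part. Elsewhere the integrand has non-negative real part, and at `t = 1` its
  -- value is `1`.
  · have hpos : 0 < ∫ t, RCLike.re (φ z₀ t) ∂μ := by
      have hre : ∀ t : K, RCLike.re (φ z₀ t) = f (act t⁻¹ z₀) * RCLike.re (t : 𝕜) := fun t => by
        simp [φ]
      refine Continuous.integral_pos_of_hasCompactSupport_nonneg_nonzero
        (RCLike.continuous_re.comp (hφz z₀)) (HasCompactSupport.of_compactSpace _) (fun t => ?_)
        (x := 1) ?_
      · change 0 ≤ RCLike.re (φ z₀ t)
        rw [hre]
        by_cases ht : RCLike.re (t : 𝕜) ≤ 1 / 2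
        · have : f (act t⁻¹ z₀) = 0 := hf0 ⟨t⁻¹, by
            have h1 : ((t⁻¹ : K) : 𝕜) = star (t : 𝕜) := by
              rw [Metric.unitSphere.coe_inv]
              exact RCLike.inv_eq_conj (mem_sphere_zero_iff_norm.1 t.2)
            change RCLike.re ((t⁻¹ : K) : 𝕜) ≤ 1 / 2
            rw [h1]
            simpa using ht, rfl⟩
          rw [this, zero_mul]
        · exact mul_nonneg (hf _).1 (by linarith)
      · have h1 : act 1⁻¹ z₀ = z₀ := by simp [act, z₀]
        have h2 : f z₀ = 1 := hf1 rfl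
        change RCLike.re (φ z₀ 1) ≠ 0
        rw [hre, h1, h2, Metric.unitSphere.coe_one, RCLike.one_re]
        norm_num
    intro h0
    have h1 := integral_re (hint z₀)
    change ∫ t, RCLike.re (φ z₀ t) ∂μ = RCLike.re (∫ t, φ z₀ t ∂μ) at h1
    change ∫ t, φ z₀ t ∂μ = 0 at h0
    rw [h0, map_zero] at h1
    exact hpos.ne' h1
  · intro s z hs
    let s' : K := ⟨s, mem_sphere_zero_iff_norm.2 hs⟩
    change ∫ t, φ (act s' z) t ∂μ = s * ∫ t, φ z t ∂μ
    rw [← MeasureTheory.integral_mul_left_eq_self (μ := μ) (fun t => φ (act s' z) t) s',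
      ← MeasureTheory.integral_const_mul]
    congr 1
    funext t
    simp only [φ, hact_mul]
    rw [show (s' * t)⁻¹ * s' = t⁻¹ by rw [mul_inv_rev, mul_assoc, inv_mul_cancel, mul_one],
      Metric.unitSphere.coe_mul]
    ring

/-- Through each point of the base passes a continuous section that does not vanish there. -/
theorem exists_section (hL : IsLineBundle 𝕜 L) [T2Space G] [LocallyCompactSpace G] (γ₀ : G) :
    ∃ a : ∀ γ, L γ, Continuous (fun γ => (⟨γ, a γ⟩ : TotalSpace 𝕜 L)) ∧ a γ₀ ≠ 0 := by
  choose v hv using hL.exists_norm_eq_one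
  have hv0 : ∀ γ, v γ ≠ 0 := fun γ h => by
    have := hv γ
    rw [h, norm_zero] at this
    exact zero_ne_one this
  obtain ⟨F, hF, hF0, hFeq⟩ := hL.exists_equivariant (hv0 γ₀)
  -- The unit vectors `v γ` are chosen without continuity. Replacing `v γ` by `t • v γ` with `‖t‖ =
  -- 1` changes nothing, so the section is the descent of a continuous map on the non-zero vectors,
  -- which are an open set with quotient `G`.
  refine ⟨fun γ => starRingEnd 𝕜 (F ⟨γ, v γ⟩) • v γ, ?_, ?_⟩
  · let E := {z : TotalSpace 𝕜 L // z.snd ≠ 0}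
    have hEo : IsOpen {z : TotalSpace 𝕜 L | z.snd ≠ 0} := by
      have : {z : TotalSpace 𝕜 L | z.snd ≠ 0} = {z | 0 < ‖z.snd‖} := by
        ext z
        simp
      rw [this]
      exact isOpen_lt continuous_const hL.continuous_norm
    have hq : IsQuotientMap (fun z : E => z.1.proj) :=
      (hL.isOpenMap_proj.comp hEo.isOpenMap_subtype_val).isQuotientMap
        (hL.continuous_proj.comp continuous_subtype_val) fun γ => ⟨⟨⟨γ, v γ⟩, hv0 γ⟩, rfl⟩
    rw [hq.continuous_iff]
    let n : E → TotalSpace 𝕜 L := fun z => ⟨z.1.proj, ((‖z.1.snd‖⁻¹ : ℝ) : 𝕜) • z.1.snd⟩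
    have hn : Continuous n := by
      refine hL.continuous_smul.comp ((RCLike.continuous_ofReal.comp ?_).prodMk
        continuous_subtype_val)
      exact (hL.continuous_norm.comp continuous_subtype_val).inv₀ fun z => norm_ne_zero_iff.2 z.2
    have hψ : Continuous fun z : E =>
        (⟨(n z).proj, starRingEnd 𝕜 (F (n z)) • (n z).snd⟩ : TotalSpace 𝕜 L) :=
      hL.continuous_smul.comp ((RCLike.continuous_conj.comp (hF.comp hn)).prodMk hn)
    refine hψ.congr ?_
    rintro ⟨⟨γ, w⟩, hw⟩
    change w ≠ 0 at hw
    obtain ⟨t, ht⟩ := hL.exists_smul_eq (hv0 γ) (((‖w‖⁻¹ : ℝ) : 𝕜) • w)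
    have ht1 : ‖t‖ = 1 := by
      have h1 := congrArg norm ht
      rw [norm_smul, hv, mul_one, norm_smul, RCLike.norm_ofReal,
        abs_of_nonneg (inv_nonneg.2 (norm_nonneg w)),
        inv_mul_cancel₀ (norm_ne_zero_iff.2 hw)] at h1
      exact h1
    have hnz : n ⟨⟨γ, w⟩, hw⟩ = ⟨γ, t • v γ⟩ := by
      simp only [n, ht]
    rw [hnz]
    have h2 := hFeq t ⟨γ, v γ⟩ ht1
    simp only at h2
    simp only [Function.comp_apply]
    rw [h2, map_mul, smul_smul, mul_right_comm]
    congr 2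
    rw [RCLike.conj_mul, ht1]
    simp
  · refine smul_ne_zero ?_ (hv0 γ₀)
    simpa using hF0

/-- A section is continuous at a point if it is close there to a multiple of a continuous section
that does not vanish. -/
theorem continuousAt_of_tendsto_norm_sub (hL : IsLineBundle 𝕜 L) {s a : ∀ γ, L γ} {γ₀ : G}
    (ha : ContinuousAt (fun γ => (⟨γ, a γ⟩ : TotalSpace 𝕜 L)) γ₀) (ha0 : a γ₀ ≠ 0) {c : 𝕜}
    (hc : c • a γ₀ = s γ₀) (hs : Tendsto (fun γ => ‖s γ - c • a γ‖) (𝓝 γ₀) (𝓝 0)) :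
    ContinuousAt (fun γ => (⟨γ, s γ⟩ : TotalSpace 𝕜 L)) γ₀ := by
  classical
  have hna : Tendsto (fun γ => ‖a γ‖) (𝓝 γ₀) (𝓝 ‖a γ₀‖) :=
    (hL.continuous_norm.tendsto _).comp ha
  have hpos : 0 < ‖a γ₀‖ := norm_pos_iff.2 ha0
  have hev : ∀ᶠ γ in 𝓝 γ₀, a γ ≠ 0 := by
    filter_upwards [hna.eventually (lt_mem_nhds hpos)] with γ hγ
    exact norm_pos_iff.1 hγ
  have hex : ∀ γ, ∃ φ : 𝕜, a γ ≠ 0 → φ • a γ = s γ := fun γ => by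
    by_cases h : a γ = 0
    · exact ⟨0, fun h' => absurd h h'⟩
    · obtain ⟨φ, hφ⟩ := hL.exists_smul_eq h (s γ)
      exact ⟨φ, fun _ => hφ⟩
  choose φ hφ using hex
  have hlim : Tendsto φ (𝓝 γ₀) (𝓝 c) := by
    rw [tendsto_iff_norm_sub_tendsto_zero]
    have h1 : Tendsto (fun γ => ‖s γ - c • a γ‖ / ‖a γ‖) (𝓝 γ₀) (𝓝 0) := by
      have := hs.div hna hpos.ne'
      rwa [zero_div] at this
    refine h1.congr' ?_
    filter_upwards [hev] with γ hγ
    rw [← hφ γ hγ, ← sub_smul, norm_smul, mul_div_cancel_right₀ _ (norm_ne_zero_iff.2 hγ)]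
  have h2 := hL.tendsto_smul hlim ha
  rw [ContinuousAt, ← hc]
  refine h2.congr' ?_
  filter_upwards [hev] with γ hγ
  simp only [hφ γ hγ]

end IsLineBundle

/-! ### Composition in a groupoid -/

namespace EtaleGroupoid

section Algebra

variable {G : Type*} [ArrowGroupoid G]

theorem r_mem_unitSpace (γ : G) : r γ ∈ unitSpace G := r_r γ

theorem d_mem_unitSpace (γ : G) : d γ ∈ unitSpace G := r_d γ

theorem r_eq_of_mem_unitSpace {x : G} (hx : x ∈ unitSpace G) : r x = x := hx

theorem d_eq_of_mem_unitSpace {x : G} (hx : x ∈ unitSpace G) : d x = x := by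
  have h := d_r x
  rwa [r_eq_of_mem_unitSpace hx] at h

theorem isComp_r_self (γ : G) : IsComp (r γ) γ γ := ⟨d_r γ, r_comp_self γ⟩

theorem isComp_self_d (γ : G) : IsComp γ (d γ) γ := ⟨(r_d γ).symm, comp_d_self γ⟩

theorem isComp_self_inv (γ : G) : IsComp γ (inv γ) (r γ) := ⟨(r_inv γ).symm, comp_inv γ⟩

theorem isComp_inv_self (γ : G) : IsComp (inv γ) γ (d γ) := ⟨d_inv γ, inv_comp γ⟩

theorem IsComp.r_eq {η κ γ : G} (h : IsComp η κ γ) : r η = r γ := by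
  rw [← h.comp_eq, r_comp _ _ h.composable]

theorem IsComp.d_eq {η κ γ : G} (h : IsComp η κ γ) : d κ = d γ := by
  rw [← h.comp_eq, d_comp _ _ h.composable]

theorem IsComp.eq_inv_comp {η κ γ : G} (h : IsComp η κ γ) : κ = comp (inv η) γ := by
  have h1 := comp_assoc (inv η) η κ (d_inv η) h.composable
  rw [h.comp_eq, inv_comp, h.composable, r_comp_self] at h1
  exact h1

theorem IsComp.eq_comp_inv {η κ γ : G} (h : IsComp η κ γ) : η = comp γ (inv κ) := by
  have h1 := comp_assoc η κ (inv κ) h.composable (r_inv κ).symm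
  rw [h.comp_eq, comp_inv, ← h.composable, comp_d_self] at h1
  exact h1.symm

theorem inv_inv_arrow (γ : G) : inv (inv γ) = γ := by
  have h1 := (isComp_self_inv (inv γ)).eq_inv_comp
  have h2 := isComp_inv_self γ
  rw [← r_inv γ] at h2
  rw [h1, ← h2.eq_inv_comp]

end Algebra

variable (G : Type*) [TopologicalSpace G] [EtaleGroupoid G]

theorem isOpen_unitSpace : IsOpen (unitSpace G) := by
  have h : unitSpace G = Set.range (r : G → G) := by
    ext x
    exact ⟨fun hx => ⟨x, hx⟩, fun ⟨γ, hγ⟩ => hγ ▸ r_mem_unitSpace γ⟩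
  rw [h]
  exact isLocalHomeomorph_r.isOpenMap.isOpen_range

theorem isClosed_unitSpace [T2Space G] : IsClosed (unitSpace G) :=
  isClosed_eq continuous_r continuous_id

variable {G}

/-- Every arrow has an open neighbourhood on which `r` and `d` are injective. -/
theorem exists_isOpenBisection (γ : G) : ∃ U : Set G, γ ∈ U ∧ IsOpenBisection U := by
  obtain ⟨e, he, her⟩ := isLocalHomeomorph_r (G := G) γ
  obtain ⟨e', he', her'⟩ := isLocalHomeomorph_r (G := G) (inv γ)
  refine ⟨e.source ∩ inv ⁻¹' e'.source, ⟨he, he'⟩,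
    e.open_source.inter (e'.open_source.preimage continuous_inv), ?_, ?_⟩
  · rw [her]
    exact e.injOn.mono Set.inter_subset_left
  · intro α hα β hβ h
    have h1 : inv α = inv β := e'.injOn hα.2 hβ.2 (by rw [← her', r_inv, r_inv, h])
    rw [← inv_inv_arrow α, h1, inv_inv_arrow]

end EtaleGroupoid

/-! ### Scalar bump functions -/

theorem exists_bump {𝕜 : Type*} [RCLike 𝕜] {X : Type*} [TopologicalSpace X] [T2Space X]
    [LocallyCompactSpace X] {K U : Set X} (hK : IsCompact K) (hU : IsOpen U) (hKU : K ⊆ U) :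
    ∃ c : X → 𝕜, Continuous c ∧ HasCompactSupport c ∧ tsupport c ⊆ U ∧ (∀ x ∈ K, c x = 1) ∧
      ∀ x, ‖c x‖ ≤ 1 := by
  obtain ⟨f, hf1, hfc, hfU, hf⟩ := exists_continuousMap_one_of_isCompact_subset_isOpen hK hU hKU
  have hsub : tsupport (fun x => ((f x : ℝ) : 𝕜)) ⊆ tsupport f := by
    refine closure_mono fun x hx => ?_
    intro h0
    apply hx
    simp [h0]
  refine ⟨fun x => ((f x : ℝ) : 𝕜), RCLike.continuous_ofReal.comp f.continuous,
    hfc.of_isClosed_subset (isClosed_tsupport _) hsub, hsub.trans hfU, fun x hx => ?_, fun x => ?_⟩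
  · simp [hf1 hx]
  · rw [RCLike.norm_ofReal, abs_of_nonneg (hf x).1]
    exact (hf x).2

namespace Twist

variable {𝕜 : Type*} [RCLike 𝕜] {G : Type*} [TopologicalSpace G] [EtaleGroupoid G]
  {L : G → Type*} [∀ γ, NormedAddCommGroup (L γ)] [∀ γ, NormedSpace 𝕜 (L γ)]
  [TopologicalSpace (TotalSpace 𝕜 L)] (T : Twist 𝕜 L)

/-! ### Evaluation of convolutions -/

theorem mul_apply_ne_zero {γ η ζ : G} (h : IsComp γ η ζ) {z : L γ} {w : L η} (hz : z ≠ 0)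
    (hw : w ≠ 0) :
    T.mul h z w ≠ 0 := by
  rw [← norm_ne_zero_iff, T.norm_mul]
  exact mul_ne_zero (norm_ne_zero_iff.2 hz) (norm_ne_zero_iff.2 hw)

theorem mul_inv_comp_eq (f g : ∀ γ, L γ) {η κ γ : G} (h : IsComp η κ γ) (hη : r η = r γ) :
    T.mul (isComp_inv_comp hη) (f η) (g (comp (inv η) γ)) = T.mul h (f η) (g κ) := by
  obtain rfl := h.eq_inv_comp
  rfl

/-- Supports in bisections, or in the unit space, make the contributing factorisation of `γ` unique;
convolutions then become fibrewise products, which do not vanish if the factors do not. -/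
theorem conv_eq_single {f g : ∀ γ, L γ} {η κ γ : G} (h : IsComp η κ γ)
    (hu : ∀ η' κ' : G, IsComp η' κ' γ → f η' ≠ 0 → g κ' ≠ 0 → η' = η) :
    T.conv f g γ = T.mul h (f η) (g κ) := by
  rw [conv, finsum_eq_single _ (⟨η, h.r_eq⟩ : {η : G // r η = r γ})]
  · exact T.mul_inv_comp_eq f g h h.r_eq
  · rintro ⟨η', hη'⟩ hne
    by_contra h0
    refine hne (Subtype.ext (hu η' _ (isComp_inv_comp hη') ?_ ?_))
    · intro h1
      simp [h1] at h0
    · intro h1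
      simp [h1] at h0

theorem conv_eq_zero {f g : ∀ γ, L γ} {γ : G}
    (h0 : ∀ η κ : G, IsComp η κ γ → f η ≠ 0 → g κ ≠ 0 → False) : T.conv f g γ = 0 := by
  rw [conv]
  refine finsum_eq_zero_of_forall_eq_zero fun ⟨η, hη⟩ => ?_
  by_cases h1 : f η = 0
  · simp [h1]
  by_cases h2 : g (comp (inv η) γ) = 0
  · simp [h2]
  exact (h0 _ _ (isComp_inv_comp hη) h1 h2).elim

/-! ### Sections over the unit space -/

theorem norm_one_apply {x : G} (hx : x ∈ unitSpace G) : ‖T.one x hx‖ = 1 := by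
  obtain ⟨v, hv⟩ := T.isLineBundle.exists_norm_eq_one x
  have hc : IsComp x x x := by
    have := isComp_r_self x
    rwa [r_eq_of_mem_unitSpace hx] at this
  have h := T.norm_mul hc (T.one x hx) v
  rw [T.one_mul hx hc, hv, _root_.mul_one] at h
  exact h.symm

open Classical in
/-- The section `x ↦ c x • 1` over the unit space, extended by zero. -/
noncomputable def unitSec (c : G → 𝕜) (γ : G) : L γ :=
  if h : γ ∈ unitSpace G then c γ • T.one γ h else 0

theorem unitSec_of_mem (c : G → 𝕜) {x : G} (hx : x ∈ unitSpace G) :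
    T.unitSec c x = c x • T.one x hx := dif_pos hx

theorem unitSec_of_notMem (c : G → 𝕜) {γ : G} (hγ : γ ∉ unitSpace G) : T.unitSec c γ = 0 :=
  dif_neg hγ

theorem norm_unitSec_of_mem (c : G → 𝕜) {x : G} (hx : x ∈ unitSpace G) :
    ‖T.unitSec c x‖ = ‖c x‖ := by
  rw [T.unitSec_of_mem c hx, norm_smul, T.norm_one_apply hx, _root_.mul_one]

theorem norm_unitSec_le (c : G → 𝕜) (γ : G) : ‖T.unitSec c γ‖ ≤ ‖c γ‖ := by
  by_cases hγ : γ ∈ unitSpace G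
  · exact (T.norm_unitSec_of_mem c hγ).le
  · rw [T.unitSec_of_notMem c hγ, norm_zero]
    exact norm_nonneg _

theorem exists_eq_unitSec {f : ∀ γ, L γ} (hf : ∀ γ, γ ∉ unitSpace G → f γ = 0) :
    ∃ c : G → 𝕜, (∀ γ, γ ∉ unitSpace G → c γ = 0) ∧ f = T.unitSec c := by
  classical
  have h : ∀ γ, ∃ c : 𝕜, (γ ∉ unitSpace G → c = 0) ∧
      ∀ hγ : γ ∈ unitSpace G, c • T.one γ hγ = f γ := fun γ => by
    by_cases hγ : γ ∈ unitSpace G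
    · obtain ⟨c, hc⟩ := T.isLineBundle.exists_smul_eq
        (norm_ne_zero_iff.1 ((T.norm_one_apply hγ).trans_ne one_ne_zero)) (f γ)
      exact ⟨c, fun h => absurd hγ h, fun _ => hc⟩
    · exact ⟨0, fun _ => rfl, fun h => absurd h hγ⟩
  choose c hc0 hc using h
  refine ⟨c, hc0, ?_⟩
  funext γ
  by_cases hγ : γ ∈ unitSpace G
  · rw [T.unitSec_of_mem c hγ, hc]
  · rw [T.unitSec_of_notMem c hγ, hf γ hγ]

theorem conv_unitSec_left (c : G → 𝕜) (g : ∀ γ, L γ) (γ : G) :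
    T.conv (T.unitSec c) g γ = c (r γ) • g γ := by
  rw [T.conv_eq_single (isComp_r_self γ)]
  · rw [T.unitSec_of_mem c (r_mem_unitSpace γ), map_smul, LinearMap.smul_apply, T.one_mul]
  · intro η κ h hη _
    have hηX : η ∈ unitSpace G := by
      by_contra hcon
      exact hη (T.unitSec_of_notMem c hcon)
    rw [← h.r_eq, r_eq_of_mem_unitSpace hηX]

theorem conv_unitSec_right (c : G → 𝕜) (g : ∀ γ, L γ) (γ : G) :
    T.conv g (T.unitSec c) γ = c (d γ) • g γ := by
  rw [T.conv_eq_single (isComp_self_d γ)]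
  · rw [T.unitSec_of_mem c (d_mem_unitSpace γ), map_smul, T.mul_one]
  · intro η κ h _ hκ
    have hκX : κ ∈ unitSpace G := by
      by_contra hcon
      exact hκ (T.unitSec_of_notMem c hcon)
    have h1 := h.comp_eq
    rwa [← r_eq_of_mem_unitSpace hκX, ← h.composable, comp_d_self] at h1

theorem conv_unitSec_unitSec (c c' : G → 𝕜) :
    T.conv (T.unitSec c) (T.unitSec c') = T.unitSec (fun x => c x * c' x) := by
  funext γ
  rw [T.conv_unitSec_left]
  by_cases hγ : γ ∈ unitSpace G
  · rw [T.unitSec_of_mem _ hγ, T.unitSec_of_mem _ hγ, r_eq_of_mem_unitSpace hγ, smul_smul]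
  · rw [T.unitSec_of_notMem _ hγ, T.unitSec_of_notMem _ hγ, smul_zero]

theorem continuous_unitSec [T2Space G] {c : G → 𝕜} (hc : Continuous c) :
    Continuous (fun γ => (⟨γ, T.unitSec c γ⟩ : TotalSpace 𝕜 L)) := by
  refine continuous_iff_continuousAt.2 fun γ => ?_
  by_cases hγ : γ ∈ unitSpace G
  · refine ((isOpen_unitSpace G).isOpenEmbedding_subtypeVal.continuousAt_iff
      (g := fun γ => (⟨γ, T.unitSec c γ⟩ : TotalSpace 𝕜 L)) (x := ⟨γ, hγ⟩)).1 ?_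
    have h2 : Continuous (fun x : unitSpace G =>
        (⟨x.1, c x.1 • T.one x.1 x.2⟩ : TotalSpace 𝕜 L)) :=
      T.isLineBundle.continuous_smul.comp
        ((hc.comp continuous_subtype_val).prodMk T.continuous_one)
    refine (h2.congr fun x => ?_).continuousAt
    simp only [Function.comp_apply, T.unitSec_of_mem c x.2]
  · refine T.continuous_zero.continuousAt.congr ?_
    filter_upwards [(isClosed_unitSpace G).isOpen_compl.mem_nhds hγ] with η hη
    rw [T.unitSec_of_notMem c hη]

/-- The unit section has norm one, so near a unit the norm of the difference from a constant
multiple of it is exactly the distance of coefficients. -/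
theorem continuous_of_unitSec [T2Space G] {c : G → 𝕜} (hc0 : ∀ γ, γ ∉ unitSpace G → c γ = 0)
    (hc : Continuous (fun γ => (⟨γ, T.unitSec c γ⟩ : TotalSpace 𝕜 L))) : Continuous c := by
  refine continuous_iff_continuousAt.2 fun γ => ?_
  by_cases hγ : γ ∈ unitSpace G
  · have h1 := T.isLineBundle.tendsto_norm_sub (hc.tendsto γ)
      ((T.continuous_unitSec (continuous_const (y := c γ))).tendsto γ)
    rw [T.unitSec_of_mem c hγ, T.unitSec_of_mem _ hγ, sub_self, norm_zero] at h1
    rw [ContinuousAt, tendsto_iff_norm_sub_tendsto_zero]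
    refine h1.congr' ?_
    filter_upwards [(isOpen_unitSpace G).mem_nhds hγ] with x hx
    rw [T.unitSec_of_mem c hx, T.unitSec_of_mem _ hx, ← sub_smul, norm_smul, T.norm_one_apply hx,
      _root_.mul_one]
  · refine (continuousAt_const (y := (0 : 𝕜))).congr ?_
    filter_upwards [(isClosed_unitSpace G).isOpen_compl.mem_nhds hγ] with η hη
    exact (hc0 η hη).symm

/-! ### Compactly supported sections -/

theorem continuous_smul_fun (T : Twist 𝕜 L) {c : G → 𝕜} (hc : Continuous c) {f : ∀ γ, L γ}
    (hf : Continuous (fun γ => (⟨γ, f γ⟩ : TotalSpace 𝕜 L))) :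
    Continuous (fun γ => (⟨γ, c γ • f γ⟩ : TotalSpace 𝕜 L)) :=
  T.isLineBundle.continuous_smul.comp (hc.prodMk hf)

/-- A bump function times the section of `IsLineBundle.exists_section`; this supplies every test
element of the convolution algebra used below. -/
theorem exists_mem_Cc [T2Space G] [LocallyCompactSpace G] {U : Set G} (hU : IsOpen U) {γ : G}
    (hγ : γ ∈ U) : ∃ a : T.Cc, SupportedIn a U ∧ a.1 γ ≠ 0 := by
  obtain ⟨s, hs, hs0⟩ := T.isLineBundle.exists_section γ
  obtain ⟨c, hc, hcs, hcU, hc1, -⟩ := exists_bump (𝕜 := 𝕜) isCompact_singleton hU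
    (Set.singleton_subset_iff.2 hγ)
  have hsub : tsupport (fun γ => ‖c γ • s γ‖) ⊆ tsupport c := by
    refine closure_mono fun η hη h0 => hη ?_
    simp [h0]
  refine ⟨⟨fun γ => c γ • s γ, T.continuous_smul_fun hc hs,
    hcs.isCompact.of_isClosed_subset (isClosed_tsupport _) hsub⟩, hsub.trans hcU, ?_⟩
  simpa [hc1 γ rfl] using hs0

variable {T}

theorem eq_zero_of_supportedIn {f : T.Cc} {U : Set G} (hf : SupportedIn f U) {γ : G}
    (hγ : γ ∉ U) : f.1 γ = 0 := by
  by_contra h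
  exact hγ (hf (subset_tsupport _ (by simpa using h)))

theorem norm_le_supNorm (f : T.Cc) (γ : G) : ‖f.1 γ‖ ≤ supNorm f :=
  le_ciSup ((T.continuous_norm_section f.2.1).bddAbove_range_of_hasCompactSupport f.2.2) γ

theorem supNorm_le {f : T.Cc} {C : ℝ} (hC : 0 ≤ C) (h : ∀ γ, ‖f.1 γ‖ ≤ C) : supNorm f ≤ C :=
  Real.iSup_le h hC

theorem supNorm_nonneg (f : T.Cc) : 0 ≤ supNorm f := Real.iSup_nonneg fun _ => norm_nonneg _

theorem supportedIn_unitSpace_iff [T2Space G] {f : T.Cc} :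
    SupportedIn f (unitSpace G) ↔ ∀ γ, γ ∉ unitSpace G → f.1 γ = 0 := by
  refine ⟨fun h γ hγ => eq_zero_of_supportedIn h hγ, fun h => ?_⟩
  refine closure_minimal (fun γ hγ => ?_) (isClosed_unitSpace G)
  by_contra hcon
  apply hγ
  simp [h γ hcon]

variable (T) in
/-- The element `c • 1` of `C_c(X)`. -/
noncomputable def unitCc [T2Space G] (c : G → 𝕜) (hc : Continuous c) (hcs : HasCompactSupport c) :
    T.Cc :=
  ⟨T.unitSec c, T.continuous_unitSec hc, hcs.isCompact.of_isClosed_subset (isClosed_tsupport _)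
    (closure_mono fun γ hγ h0 => hγ (le_antisymm
      ((T.norm_unitSec_le c γ).trans (by simp [h0])) (norm_nonneg _)))⟩

@[simp]
theorem coe_unitCc [T2Space G] {c : G → 𝕜} (hc : Continuous c) (hcs : HasCompactSupport c) :
    (T.unitCc c hc hcs).1 = T.unitSec c := rfl

theorem supportedIn_unitCc [T2Space G] {c : G → 𝕜} (hc : Continuous c)
    (hcs : HasCompactSupport c) : SupportedIn (T.unitCc c hc hcs) (unitSpace G) :=
  supportedIn_unitSpace_iff.2 fun _ hγ => T.unitSec_of_notMem c hγ

theorem exists_eq_unitCc [T2Space G] {f : T.Cc} (hf : SupportedIn f (unitSpace G)) :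
    ∃ (c : G → 𝕜) (hc : Continuous c) (hcs : HasCompactSupport c),
      (∀ γ, γ ∉ unitSpace G → c γ = 0) ∧ f = T.unitCc c hc hcs := by
  obtain ⟨c, hc0, hc⟩ := T.exists_eq_unitSec (supportedIn_unitSpace_iff.1 hf)
  have hcont : Continuous c := T.continuous_of_unitSec hc0 (hc ▸ f.2.1)
  have hcs : HasCompactSupport c := by
    refine f.2.2.of_isClosed_subset (isClosed_tsupport _) (closure_mono fun γ hγ h0 => hγ ?_)
    by_cases hγX : γ ∈ unitSpace G
    · change ‖f.1 γ‖ = 0 at h0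
      rw [hc, T.norm_unitSec_of_mem c hγX] at h0
      exact norm_eq_zero.1 h0
    · exact hc0 γ hγX
  exact ⟨c, hcont, hcs, hc0, Subtype.ext hc⟩

theorem coe_mul [T2Space G] (f g : T.Cc) : (f * g).1 = T.conv f.1 g.1 := rfl

end Twist

namespace Twist

variable {𝕜 : Type*} [RCLike 𝕜] {G : Type*} [TopologicalSpace G] [EtaleGroupoid G]
  {L : G → Type*} [∀ γ, NormedAddCommGroup (L γ)] [∀ γ, NormedSpace 𝕜 (L γ)]
  [TopologicalSpace (TotalSpace 𝕜 L)] (T : Twist 𝕜 L)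

/-! ### Continuity of the convolution in one factor -/

theorem continuous_mul_right {γ η ζ : G} (h : IsComp γ η ζ) (z : L γ) :
    Continuous fun w : L η => T.mul h z w :=
  AddMonoidHomClass.continuous_of_bound (T.mul h z) ‖z‖ fun w => (T.norm_mul h z w).le

theorem continuous_mul_left {γ η ζ : G} (h : IsComp γ η ζ) (w : L η) :
    Continuous fun z : L γ => T.mul h z w :=
  AddMonoidHomClass.continuous_of_bound ((T.mul h).flip w) ‖w‖ fun z => by
    rw [LinearMap.flip_apply, T.norm_mul, mul_comm]

/-- The point is that the finite index set depends on `f` and `γ` only, so the same sum serves for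
every `g` and limits in `g` can be taken termwise. -/
theorem exists_finset_conv_eq_of_left {f : ∀ γ, L γ} {γ : G}
    (hf : {η | r η = r γ ∧ f η ≠ 0}.Finite) :
    ∃ F : Finset {η : G // r η = r γ}, ∀ g : ∀ γ, L γ, T.conv f g γ =
      ∑ η ∈ F, T.mul (isComp_inv_comp η.2) (f η.1) (g (comp (inv η.1) γ)) := by
  have hfin : {η : {η : G // r η = r γ} | f η.1 ≠ 0}.Finite := by
    refine (hf.preimage (f := Subtype.val) Subtype.val_injective.injOn).subset ?_
    exact fun η hη => ⟨η.2, hη⟩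
  refine ⟨hfin.toFinset, fun g => finsum_eq_sum_of_support_subset _ fun η hη => ?_⟩
  rw [hfin.coe_toFinset]
  intro h0
  apply hη
  simp [h0]

theorem exists_finset_conv_eq_of_right {g : ∀ γ, L γ} {γ : G}
    (hg : {κ | d κ = d γ ∧ g κ ≠ 0}.Finite) :
    ∃ F : Finset {η : G // r η = r γ}, ∀ f : ∀ γ, L γ, T.conv f g γ =
      ∑ η ∈ F, T.mul (isComp_inv_comp η.2) (f η.1) (g (comp (inv η.1) γ)) := by
  have hfin : {η : {η : G // r η = r γ} | g (comp (inv η.1) γ) ≠ 0}.Finite := by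
    refine (hg.preimage (f := fun η : {η : G // r η = r γ} => comp (inv η.1) γ) ?_).subset ?_
    · intro η _ η' _ h
      have h1 := (isComp_inv_comp η.2).eq_comp_inv
      have h2 := (isComp_inv_comp η'.2).eq_comp_inv
      refine Subtype.ext ?_
      change comp (inv η.1) γ = comp (inv η'.1) γ at h
      rw [h1, h2, h]
    · exact fun η hη => ⟨(isComp_inv_comp η.2).d_eq, hη⟩
  refine ⟨hfin.toFinset, fun f => finsum_eq_sum_of_support_subset _ fun η hη => ?_⟩
  rw [hfin.coe_toFinset]
  intro h0
  apply hη
  simp [h0]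

theorem tendsto_conv_right {f : ∀ γ, L γ} {γ : G} (hf : {η | r η = r γ ∧ f η ≠ 0}.Finite)
    {ι : Type*} {l : Filter ι} {u : ι → ∀ γ, L γ} {g : ∀ γ, L γ}
    (hu : ∀ κ, Tendsto (fun k => u k κ) l (𝓝 (g κ))) :
    Tendsto (fun k => T.conv f (u k) γ) l (𝓝 (T.conv f g γ)) := by
  obtain ⟨F, hF⟩ := T.exists_finset_conv_eq_of_left hf
  simp only [hF]
  exact tendsto_finsetSum _ fun η _ => ((T.continuous_mul_right _ _).tendsto _).comp (hu _)

theorem tendsto_conv_left {g : ∀ γ, L γ} {γ : G} (hg : {κ | d κ = d γ ∧ g κ ≠ 0}.Finite)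
    {ι : Type*} {l : Filter ι} {u : ι → ∀ γ, L γ} {f : ∀ γ, L γ}
    (hu : ∀ η, Tendsto (fun k => u k η) l (𝓝 (f η))) :
    Tendsto (fun k => T.conv (u k) g γ) l (𝓝 (T.conv f g γ)) := by
  obtain ⟨F, hF⟩ := T.exists_finset_conv_eq_of_right hg
  simp only [hF]
  exact tendsto_finsetSum _ fun η _ => ((T.continuous_mul_left _ _).tendsto _).comp (hu _)

variable {T}

/-- The fibres of a locally injective map are discrete, so each meets the compact support in a
finite set. -/
theorem finite_ne_zero_of_injOn [T2Space G] (f : T.Cc) {p : G → G} (hp : Continuous p)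
    (hloc : ∀ γ, ∃ U : Set G, IsOpen U ∧ γ ∈ U ∧ Set.InjOn p U) (x : G) :
    {η | p η = x ∧ f.1 η ≠ 0}.Finite := by
  choose U hUo hUm hUi using hloc
  have hK : IsCompact (tsupport (fun γ => ‖f.1 γ‖) ∩ {η | p η = x}) :=
    IsCompact.inter_right f.2.2 (isClosed_eq hp continuous_const)
  obtain ⟨t, -, ht⟩ := hK.elim_nhds_subcover U fun η _ => (hUo η).mem_nhds (hUm η)
  have hsub : {η | p η = x ∧ f.1 η ≠ 0} ⊆ ⋃ y ∈ t, U y ∩ {η | p η = x} := by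
    rintro η ⟨hη, hfη⟩
    obtain ⟨y, hy, hyU⟩ := Set.mem_iUnion₂.1
      (ht ⟨subset_tsupport _ (by simpa using hfη), hη⟩)
    exact Set.mem_iUnion₂.2 ⟨y, hy, hyU, hη⟩
  refine Set.Finite.subset (t.finite_toSet.biUnion fun y _ => ?_) hsub
  exact Set.Subsingleton.finite fun a ha b hb => hUi y ha.1 hb.1 (ha.2.trans hb.2.symm)

theorem finite_r_eq [T2Space G] (f : T.Cc) (x : G) : {η | r η = x ∧ f.1 η ≠ 0}.Finite :=
  finite_ne_zero_of_injOn f continuous_r (fun γ => by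
    obtain ⟨U, hγ, hU⟩ := exists_isOpenBisection γ
    exact ⟨U, hU.1, hγ, hU.2.1⟩) x

theorem finite_d_eq [T2Space G] (f : T.Cc) (x : G) : {η | d η = x ∧ f.1 η ≠ 0}.Finite :=
  finite_ne_zero_of_injOn f continuous_d (fun γ => by
    obtain ⟨U, hγ, hU⟩ := exists_isOpenBisection γ
    exact ⟨U, hU.1, hγ, hU.2.2⟩) x

/-! ### The inclusion of a reduced completion in `C_0(G, L)` -/

section Inclusion

variable {B : Type*} [NonUnitalNormedRing B] [NormedSpace 𝕜 B]

/-- `j` is an injective contractive extension to `B` of the inclusion of `C_c(G, L)` in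
`C_0(G, L)`. -/
structure IsInclusion (i : T.Cc →ₗ[𝕜] B) (j : B →ₗ[𝕜] T.C0) : Prop where
  norm_le : ∀ b γ, ‖(j b).1 γ‖ ≤ ‖b‖
  map_apply : ∀ f : T.Cc, (j (i f)).1 = f.1
  injective : Function.Injective j

variable {i : T.Cc →ₗ[𝕜] B} {j : B →ₗ[𝕜] T.C0}

theorem IsInclusion.continuous_apply (hj : IsInclusion i j) (γ : G) :
    Continuous fun b => (j b).1 γ :=
  AddMonoidHomClass.continuous_of_bound
    ((LinearMap.proj γ : (∀ γ, L γ) →ₗ[𝕜] L γ) ∘ₗ T.C0.subtype ∘ₗ j) 1 fun b => by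
    rw [_root_.one_mul]
    exact hj.norm_le b γ

variable [T2Space G]

/-- With one factor in `C_c(G, L)` the sum at `γ` is finite, so both sides are continuous in `b` and
density reduces to two elements of `C_c(G, L)`. This avoids convolving two general elements of
`C_0(G, L)`. -/
theorem IsInclusion.apply_mul_left (hj : IsInclusion i j) (hi : IsBanachCompletion i) (a : T.Cc)
    (b : B) (γ : G) : (j (i a * b)).1 γ = T.conv a.1 (j b).1 γ := by
  refine hi.denseRange.induction_on (p := fun b => (j (i a * b)).1 γ = T.conv a.1 (j b).1 γ) b
    (isClosed_eq ((hj.continuous_apply γ).comp (continuous_const.mul continuous_id)) ?_)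
    fun f => ?_
  · exact continuous_iff_continuousAt.2 fun b => T.tendsto_conv_right (finite_r_eq a _)
      fun κ => (hj.continuous_apply κ).tendsto b
  · rw [← hi.map_mul, hj.map_apply, hj.map_apply, coe_mul]

theorem IsInclusion.apply_mul_right (hj : IsInclusion i j) (hi : IsBanachCompletion i) (a : T.Cc)
    (b : B) (γ : G) : (j (b * i a)).1 γ = T.conv (j b).1 a.1 γ := by
  refine hi.denseRange.induction_on (p := fun b => (j (b * i a)).1 γ = T.conv (j b).1 a.1 γ) b
    (isClosed_eq ((hj.continuous_apply γ).comp (continuous_id.mul continuous_const)) ?_)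
    fun f => ?_
  · exact continuous_iff_continuousAt.2 fun b => T.tendsto_conv_left (finite_d_eq a _)
      fun κ => (hj.continuous_apply κ).tendsto b
  · rw [← hi.map_mul, hj.map_apply, hj.map_apply, coe_mul]

theorem IsBanachCompletion.exists_norm_sub_lt (hi : IsBanachCompletion i) (b : B) {ε : ℝ}
    (hε : 0 < ε) : ∃ a : T.Cc, ‖b - i a‖ < ε := by
  obtain ⟨a, ha⟩ := hi.denseRange.exists_dist_lt b hε
  exact ⟨a, by rwa [← dist_eq_norm]⟩

end Inclusion

end Twist

/-! ### Units without isotropy in a compact set -/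

namespace EtaleGroupoid

variable {G : Type*} [TopologicalSpace G] [T2Space G] [EtaleGroupoid G]

/-- The isotropy arrows of `K` are covered by finitely many compact subsets of bisections. Each
contributes a closed set of units with empty interior, and so does the finite union. Compactness
thus takes the place of a Baire category argument, and no countability of `G` is needed. -/
theorem exists_no_isotropy [LocallyCompactSpace G] (hG : IsTopologicallyFree G) {K : Set G}
    (hK : IsCompact K)
    (hKX : Disjoint K (unitSpace G)) {O : Set G} (hO : IsOpen O) (hOne : O.Nonempty) :
    ∃ y ∈ O, ∀ γ ∈ K, ¬(r γ = y ∧ d γ = y) := by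
  have hKZ : ∀ C : Set G, IsCompact C → IsCompact (C ∩ {γ | r γ = d γ}) := fun C hC =>
    hC.inter_right (isClosed_eq continuous_r continuous_d)
  have key : IsClosed ((r : G → G) '' (K ∩ {γ | r γ = d γ})) ∧
      interior ((r : G → G) '' (K ∩ {γ | r γ = d γ})) = ∅ := by
    refine ⟨((hKZ K hK).image continuous_r).isClosed, ?_⟩
    -- The induction is over arbitrary subsets `C`; the compact set `D ⊇ C` is carried along so that
    -- the images under `r` stay closed.
    have hind := hK.induction_on
      (p := fun C => ∃ D : Set G, C ⊆ D ∧ IsCompact D ∧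
        interior ((r : G → G) '' (K ∩ D ∩ {γ | r γ = d γ})) = ∅)
      ⟨∅, subset_rfl, isCompact_empty, by simp⟩
      (fun C C' hC ⟨D, h, h'⟩ => ⟨D, hC.trans h, h'⟩)
      (fun C C' ⟨D, h1, h2, h3⟩ ⟨D', h1', h2', h3'⟩ =>
        ⟨D ∪ D', Set.union_subset_union h1 h1', h2.union h2', by
          rw [Set.inter_union_distrib_left, Set.union_inter_distrib_right, Set.image_union,
            interior_union_isClosed_of_interior_empty _ h3', h3]
          exact ((hKZ _ (hK.inter h2)).image continuous_r).isClosed⟩) ?_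
    · obtain ⟨D, hD, -, hint⟩ := hind
      rwa [Set.inter_eq_left.2 hD] at hint
    · intro γ hγ
      obtain ⟨U, hγU, hU⟩ := exists_isOpenBisection γ
      obtain ⟨D, hD, hDU, hDc⟩ := local_compact_nhds (hU.1.mem_nhds hγU)
      refine ⟨D, mem_nhdsWithin_of_mem_nhds hD, D, subset_rfl, hDc, ?_⟩
      by_contra hne
      obtain ⟨y, hy⟩ := Set.nonempty_iff_ne_empty.2 hne
      set W := interior ((r : G → G) '' (K ∩ D ∩ {γ | r γ = d γ})) with hW
      -- Since `r` is injective on `U`, an interior point of the image forces a whole open piece of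
      -- `U` to consist of isotropy arrows in `K`, hence outside the unit space.
      have hmem : ∀ η ∈ U ∩ r ⁻¹' W, η ∈ K ∧ r η = d η := by
        rintro η ⟨hηU, hηW⟩
        obtain ⟨η', ⟨⟨hη'K, hη'D⟩, hη'⟩, hr⟩ := interior_subset hηW
        have : η' = η := hU.2.1 (hDU hη'D) hηU hr
        rw [← this]
        exact ⟨hη'K, hη'⟩
      have hempty := hG (U ∩ r ⁻¹' W) (hU.1.inter (isOpen_interior.preimage continuous_r))
        (fun η hη hηX => Set.disjoint_left.1 hKX (hmem η hη).1 hηX) (fun η hη => (hmem η hη).2)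
      obtain ⟨η, ⟨⟨hηK, hηD⟩, hη⟩, hr⟩ := interior_subset hy
      have : η ∈ U ∩ r ⁻¹' W := ⟨hDU hηD, by rw [Set.mem_preimage, hr]; exact hy⟩
      rw [hempty] at this
      exact this
  by_contra hcon
  push Not at hcon
  have hsub : O ⊆ (r : G → G) '' (K ∩ {γ | r γ = d γ}) := fun y hy => by
    obtain ⟨γ, hγ, h1, h2⟩ := hcon y hy
    exact ⟨γ, ⟨hγ, h1.trans h2.symm⟩, h1⟩
  have := hO.subset_interior_iff.2 hsub
  rw [key.2] at this
  exact hOne.ne_empty (Set.subset_empty_iff.1 this)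

/-- The image of `K` under `(r, d)` is compact, hence closed, and misses `(y, y)`; so it misses a
square around that point. -/
theorem exists_open_no_arrow {K : Set G} (hK : IsCompact K) {y : G}
    (hy : ∀ γ ∈ K, ¬(r γ = y ∧ d γ = y)) :
    ∃ N : Set G, IsOpen N ∧ y ∈ N ∧ ∀ γ ∈ K, ¬(r γ ∈ N ∧ d γ ∈ N) := by
  have hcl : IsClosed ((fun γ : G => ((r γ, d γ) : G × G)) '' K) :=
    (hK.image (continuous_r.prodMk continuous_d)).isClosed
  have hmem : (y, y) ∈ ((fun γ : G => ((r γ, d γ) : G × G)) '' K)ᶜ := by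
    rintro ⟨γ, hγ, h⟩
    exact hy γ hγ (Prod.mk.inj h)
  obtain ⟨u, v, hu, hv, hyu, hyv, huv⟩ := isOpen_prod_iff.1 hcl.isOpen_compl y y hmem
  refine ⟨u ∩ v, hu.inter hv, ⟨hyu, hyv⟩, fun γ hγ h => ?_⟩
  exact huv (Set.mk_mem_prod h.1.1 h.2.2) ⟨γ, hγ, rfl⟩

end EtaleGroupoid

/-! ### Ideals of reduced completions -/

/-- A Neumann series without a unit: telescoping gives `b - aⁿb ∈ I`, and `aⁿb → 0`. -/
theorem Submodule.mem_of_sub_mul_mem {𝕜 B : Type*} [RCLike 𝕜] [NonUnitalNormedRing B]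
    [NormedSpace 𝕜 B] {I : Submodule 𝕜 B} (hIc : IsClosed (I : Set B))
    (hI : ∀ a : B, ∀ b ∈ I, a * b ∈ I) {a b : B} (ha : ‖a‖ < 1) (hab : b - a * b ∈ I) : b ∈ I := by
  let u : ℕ → B := fun n => (fun x => a * x)^[n] b
  have hu : ∀ n, u (n + 1) = a * u n := fun n => Function.iterate_succ_apply' _ _ _
  have hmem : ∀ n, b - u n ∈ I := by
    intro n
    induction n with
    | zero => simp [u]
    | succ n ih =>
      have h := I.add_mem hab (hI a _ ih)
      rwa [mul_sub, sub_add_sub_cancel, ← hu] at h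
  have hnorm : ∀ n, ‖u n‖ ≤ ‖a‖ ^ n * ‖b‖ := by
    intro n
    induction n with
    | zero => simp [u]
    | succ n ih =>
      rw [hu, pow_succ', mul_assoc]
      exact (norm_mul_le _ _).trans (mul_le_mul_of_nonneg_left ih (norm_nonneg a))
  have hlim : Tendsto u atTop (𝓝 0) := by
    refine squeeze_zero_norm hnorm ?_
    have := (tendsto_pow_atTop_nhds_zero_of_lt_one (norm_nonneg a) ha).mul_const ‖b‖
    rwa [zero_mul] at this
  have hlim2 : Tendsto (fun n => b - u n) atTop (𝓝 b) := by
    have := (tendsto_const_nhds (x := b)).sub hlim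
    rwa [sub_zero] at this
  exact hIc.mem_of_tendsto hlim2 (Eventually.of_forall hmem)

namespace Twist

variable {𝕜 : Type*} [RCLike 𝕜] {G : Type*} [TopologicalSpace G] [EtaleGroupoid G]
  {L : G → Type*} [∀ γ, NormedAddCommGroup (L γ)] [∀ γ, NormedSpace 𝕜 (L γ)]
  [TopologicalSpace (TotalSpace 𝕜 L)] {T : Twist 𝕜 L}
  [T2Space G]
  {B : Type*} [NonUnitalNormedRing B] [NormedSpace 𝕜 B]
  {i : T.Cc →ₗ[𝕜] B} {j : B →ₗ[𝕜] T.C0}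

theorem IsReduced.norm_unitCc_le (hr : IsReduced i) {c : G → 𝕜} (hc : Continuous c)
    (hcs : HasCompactSupport c) {C : ℝ} (hC : 0 ≤ C) (h : ∀ x, ‖c x‖ ≤ C) :
    ‖i (T.unitCc c hc hcs)‖ ≤ C := by
  rw [hr.isometric_unitSpace _ (supportedIn_unitCc hc hcs)]
  exact supNorm_le hC fun γ => (T.norm_unitSec_le c γ).trans (h γ)

theorem IsBanachCompletion.map_unitCc_mul (hi : IsBanachCompletion i) {c c' : G → 𝕜}
    (hc : Continuous c) (hcs : HasCompactSupport c) (hc' : Continuous c')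
    (hcs' : HasCompactSupport c') :
    i (T.unitCc c hc hcs) * i (T.unitCc c' hc' hcs') =
      i (T.unitCc (fun x => c x * c' x) (hc.mul hc') hcs.mul_right) := by
  rw [← hi.map_mul]
  exact congrArg i (Subtype.ext (T.conv_unitSec_unitSec c c'))

variable [LocallyCompactSpace G]

/-- If a closed ideal contains an element that is close to a function in `C_c(X)` of value one at
`y`, then it contains a function in `C_c(X)` of value one at `y`. -/
theorem exists_unitCc_mem_of_norm_sub_lt (hi : IsBanachCompletion i) (hr : IsReduced i)
    {I : Submodule 𝕜 B} (hIc : IsClosed (I : Set B))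
    (hI : ∀ a : B, ∀ b ∈ I, a * b ∈ I ∧ b * a ∈ I) {φ : G → 𝕜} (hφ : Continuous φ)
    (hφs : HasCompactSupport φ) {y : G} (hy : φ y = 1) {b : B} (hb : b ∈ I)
    (hφb : ‖i (T.unitCc φ hφ hφs) - b‖ < 1 / 2) :
    ∃ (c : G → 𝕜) (hc : Continuous c) (hcs : HasCompactSupport c),
      i (T.unitCc c hc hcs) ∈ I ∧ c y = 1 := by
  have hV : IsOpen {x | ‖φ x - 1‖ < 1 / 4} :=
    isOpen_lt (hφ.sub continuous_const).norm continuous_const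
  have hyV : y ∈ {x | ‖φ x - 1‖ < 1 / 4} := by
    change ‖φ y - 1‖ < 1 / 4
    rw [hy, sub_self, norm_zero]
    norm_num
  obtain ⟨K, hK, hKV, hKc⟩ := local_compact_nhds (hV.mem_nhds hyV)
  obtain ⟨g, hg, hgs, hgV, hg1, hgn⟩ := exists_bump (𝕜 := 𝕜) hKc hV hKV
  obtain ⟨c, hc, hcs, hcK, hc1, -⟩ := exists_bump (𝕜 := 𝕜) isCompact_singleton isOpen_interior
    (Set.singleton_subset_iff.2 (mem_interior_iff_mem_nhds.2 hK))
  refine ⟨c, hc, hcs, ?_, hc1 y rfl⟩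
  -- The correction `g (1 - φ)` has norm at most `1/4`, as `φ` is within `1/4` of `1` on the support
  -- of `g`. Since `g = 1` on the support of `c`, it satisfies `φ c + g (1 - φ) c = c`.
  have he : Continuous fun x => g x * (1 - φ x) := hg.mul (continuous_const.sub hφ)
  have hes : HasCompactSupport fun x => g x * (1 - φ x) := hgs.mul_right
  have hen : ‖i (T.unitCc _ he hes)‖ ≤ 1 / 4 := by
    refine hr.norm_unitCc_le he hes (by norm_num) fun x => ?_
    by_cases hx : x ∈ tsupport g
    · have h1 : ‖φ x - 1‖ < 1 / 4 := hgV hx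
      rw [_root_.norm_mul, norm_sub_rev]
      nlinarith [hgn x, norm_nonneg (g x), norm_nonneg (φ x - 1)]
    · rw [image_eq_zero_of_notMem_tsupport hx, zero_mul, norm_zero]
      norm_num
  -- With `a = φ - b + g (1 - φ)` one has `‖a‖ < 1/2 + 1/4` and `c - a c = b c`, which lies in the
  -- ideal.
  refine Submodule.mem_of_sub_mul_mem hIc (fun a b hb => (hI a b hb).1)
    (a := i (T.unitCc φ hφ hφs) - b + i (T.unitCc _ he hes)) ?_ ?_
  · calc _ ≤ _ := norm_add_le _ _
      _ < 1 := by linarith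
  · have h1 : i (T.unitCc φ hφ hφs) * i (T.unitCc c hc hcs) +
        i (T.unitCc _ he hes) * i (T.unitCc c hc hcs) = i (T.unitCc c hc hcs) := by
      rw [hi.map_unitCc_mul, hi.map_unitCc_mul, ← map_add]
      refine congrArg i (Subtype.ext ?_)
      funext γ
      rw [Submodule.coe_add, Pi.add_apply, coe_unitCc, coe_unitCc, coe_unitCc]
      by_cases hγ : γ ∈ unitSpace G
      · rw [T.unitSec_of_mem _ hγ, T.unitSec_of_mem _ hγ, T.unitSec_of_mem _ hγ, ← add_smul]
        congr 1
        by_cases hx : γ ∈ tsupport c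
        · rw [hg1 γ (interior_subset (hcK hx))]
          ring
        · rw [image_eq_zero_of_notMem_tsupport hx]
          ring
      · rw [T.unitSec_of_notMem _ hγ, T.unitSec_of_notMem _ hγ, T.unitSec_of_notMem _ hγ, add_zero]
    have h2 : i (T.unitCc c hc hcs) - (i (T.unitCc φ hφ hφs) - b + i (T.unitCc _ he hes)) *
        i (T.unitCc c hc hcs) = b * i (T.unitCc c hc hcs) := by
      nth_rw 1 [← h1]
      rw [add_mul, sub_mul]
      abel
    rw [h2]
    exact (hI _ b hb).2

/-- Multiplying on the left by a section supported in a bisection around `γ⁻¹` carries a non-zero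
value at `γ` to one at `d γ`. -/
theorem IsInclusion.exists_mem_apply_unit_ne_zero (hj : IsInclusion i j)
    (hi : IsBanachCompletion i) {I : Submodule 𝕜 B}
    (hI : ∀ a : B, ∀ b ∈ I, a * b ∈ I ∧ b * a ∈ I) {b : B} (hb : b ∈ I) (hb0 : b ≠ 0) :
    ∃ b' ∈ I, ∃ x ∈ unitSpace G, (j b').1 x ≠ 0 := by
  obtain ⟨γ, hγ⟩ : ∃ γ, (j b).1 γ ≠ 0 := by
    by_contra hcon
    push Not at hcon
    exact hb0 (hj.injective (by rw [map_zero]; exact Subtype.ext (funext hcon)))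
  obtain ⟨U, hγU, hU⟩ := exists_isOpenBisection (inv γ)
  obtain ⟨c, hcU, hc0⟩ := T.exists_mem_Cc hU.1 hγU
  refine ⟨i c * b, (hI _ _ hb).1, d γ, d_mem_unitSpace γ, ?_⟩
  rw [hj.apply_mul_left hi, T.conv_eq_single (isComp_inv_self γ)]
  · exact T.mul_apply_ne_zero _ hc0 hγ
  · intro η κ h hη _
    refine hU.2.1 ?_ hγU ?_
    · by_contra hcon
      exact hη (eq_zero_of_supportedIn hcU hcon)
    · rw [h.r_eq, r_inv, r_d]

/-- Over a topologically free groupoid, non-zero closed ideals of reduced completions contain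
non-zero functions on the unit space. -/
theorem exists_unitCc_mem (hG : IsTopologicallyFree G) (hi : IsBanachCompletion i)
    (hr : IsReduced i) (hj : IsInclusion i j) {I : Submodule 𝕜 B} (hIc : IsClosed (I : Set B))
    (hI : ∀ a : B, ∀ b ∈ I, a * b ∈ I ∧ b * a ∈ I) {b : B} (hb : b ∈ I) (hb0 : b ≠ 0) :
    ∃ (c : G → 𝕜) (hc : Continuous c) (hcs : HasCompactSupport c),
      i (T.unitCc c hc hcs) ∈ I ∧ ∃ y ∈ unitSpace G, c y ≠ 0 := by
  obtain ⟨b', hb', x, hx, hx0⟩ := hj.exists_mem_apply_unit_ne_zero hi hI hb hb0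
  -- A third leaves `a` larger than `2ε` at `x` while it is within `ε` of the ideal. After
  -- normalising by the value at `y`, the distance to the ideal is below `1/2`.
  have hε : 0 < ‖(j b').1 x‖ / 3 := div_pos (norm_pos_iff.2 hx0) three_pos
  set ε := ‖(j b').1 x‖ / 3 with hεdef
  obtain ⟨a, ha⟩ := hi.exists_norm_sub_lt b' hε
  have hax : 2 * ε < ‖a.1 x‖ := by
    have h1 := hj.norm_le (b' - i a) x
    rw [map_sub] at h1
    change ‖(j b').1 x - (j (i a)).1 x‖ ≤ _ at h1
    rw [hj.map_apply] at h1
    have h2 := norm_sub_norm_le ((j b').1 x) (a.1 x)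
    linarith
  have hO : IsOpen (unitSpace G ∩ {γ | 2 * ε < ‖a.1 γ‖}) :=
    (isOpen_unitSpace G).inter (isOpen_lt continuous_const (T.continuous_norm_section a.2.1))
  have hK : IsCompact (tsupport (fun γ => ‖a.1 γ‖) \ unitSpace G) :=
    IsCompact.diff a.2.2 (isOpen_unitSpace G)
  obtain ⟨y, ⟨hyX, hya⟩, hy⟩ := exists_no_isotropy hG hK Set.disjoint_sdiff_left hO ⟨x, hx, hax⟩
  change 2 * ε < ‖a.1 y‖ at hya
  obtain ⟨N, hN, hyN, hNK⟩ := exists_open_no_arrow hK hy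
  obtain ⟨h, hh, hhs, hhN, hh1, hhn⟩ := exists_bump (𝕜 := 𝕜) isCompact_singleton hN
    (Set.singleton_subset_iff.2 hyN)
  set H := T.unitCc h hh hhs with hH
  have hHn : ‖i H‖ ≤ 1 := hr.norm_unitCc_le hh hhs zero_le_one hhn
  have hfval : ∀ γ, (H * a * H).1 γ = h (d γ) • h (r γ) • a.1 γ := fun γ => by
    rw [coe_mul, coe_mul, hH, coe_unitCc, T.conv_unitSec_right, T.conv_unitSec_left]
  -- At `γ` the product is `h (d γ) h (r γ) a γ`, and no arrow of the support of `a` off `X` has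
  -- both ends in `N`.
  have hfX : SupportedIn (H * a * H) (unitSpace G) := by
    rw [supportedIn_unitSpace_iff]
    intro γ hγ
    rw [hfval]
    by_cases haγ : a.1 γ = 0
    · rw [haγ, smul_zero, smul_zero]
    · have hγK : γ ∈ tsupport (fun γ => ‖a.1 γ‖) \ unitSpace G :=
        ⟨subset_tsupport _ (by simpa using haγ), hγ⟩
      rcases not_and_or.1 (hNK γ hγK) with h1 | h1
      · rw [image_eq_zero_of_notMem_tsupport (fun h2 => h1 (hhN h2)), zero_smul, smul_zero]
      · rw [image_eq_zero_of_notMem_tsupport (fun h2 => h1 (hhN h2)), zero_smul]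
  obtain ⟨c, hc, hcs, -, hfc⟩ := exists_eq_unitCc hfX
  have hcy : 2 * ε < ‖c y‖ := by
    rw [← T.norm_unitSec_of_mem c hyX, ← coe_unitCc hc hcs, ← hfc, hfval,
      r_eq_of_mem_unitSpace hyX, d_eq_of_mem_unitSpace hyX, hh1 y rfl, one_smul, one_smul]
    exact hya
  have hcy0 : c y ≠ 0 := norm_pos_iff.1 (by linarith)
  have hb2 : i H * b' * i H ∈ I := (hI _ _ (hI _ _ hb').1).2
  have hdist : ‖i (T.unitCc c hc hcs) - i H * b' * i H‖ ≤ ε := by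
    rw [← hfc, hi.map_mul, hi.map_mul, ← sub_mul, ← mul_sub]
    refine (norm_mul_le _ _).trans ?_
    refine (mul_le_mul (norm_mul_le _ _) hHn (norm_nonneg _) (by positivity)).trans ?_
    rw [_root_.mul_one, norm_sub_rev]
    nlinarith [norm_nonneg (b' - i a), norm_nonneg (i H)]
  have hφ : Continuous fun x => (c y)⁻¹ * c x := continuous_const.mul hc
  have hφs : HasCompactSupport fun x => (c y)⁻¹ * c x := hcs.mul_left
  have hφeq : T.unitCc _ hφ hφs = (c y)⁻¹ • T.unitCc c hc hcs := by
    refine Subtype.ext (funext fun γ => ?_)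
    rw [Submodule.coe_smul, Pi.smul_apply, coe_unitCc, coe_unitCc]
    by_cases hγ : γ ∈ unitSpace G
    · rw [T.unitSec_of_mem _ hγ, T.unitSec_of_mem _ hγ, smul_smul]
    · rw [T.unitSec_of_notMem _ hγ, T.unitSec_of_notMem _ hγ, smul_zero]
  have hφb : ‖i (T.unitCc _ hφ hφs) - (c y)⁻¹ • (i H * b' * i H)‖ < 1 / 2 := by
    rw [hφeq, map_smul, ← smul_sub, norm_smul, norm_inv, inv_mul_lt_iff₀ (by linarith)]
    linarith
  obtain ⟨g, hg, hgs, hgI, hgy⟩ := exists_unitCc_mem_of_norm_sub_lt hi hr hIc hI hφ hφs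
    (inv_mul_cancel₀ hcy0) (I.smul_mem _ hb2) hφb
  exact ⟨g, hg, hgs, hgI, y, hyX, by rw [hgy]; exact one_ne_zero⟩

/-- The set of units at which some function in `C_c(X) ∩ I` does not vanish is invariant. -/
theorem exists_mem_apply_r_ne_zero (hi : IsBanachCompletion i) {I : Submodule 𝕜 B}
    (hI : ∀ a : B, ∀ b ∈ I, a * b ∈ I ∧ b * a ∈ I) {f : T.Cc}
    (hf : SupportedIn f (unitSpace G)) (hfI : i f ∈ I) {γ : G} (hγ : f.1 (d γ) ≠ 0) :
    ∃ g : T.Cc, SupportedIn g (unitSpace G) ∧ i g ∈ I ∧ g.1 (r γ) ≠ 0 := by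
  obtain ⟨W, hγW, hW⟩ := exists_isOpenBisection γ
  obtain ⟨a, haW, ha0⟩ := T.exists_mem_Cc hW.1 hγW
  obtain ⟨b, hbW, hb0⟩ := T.exists_mem_Cc (hW.1.preimage EtaleGroupoid.continuous_inv)
    (show inv γ ∈ (inv : G → G) ⁻¹' W by rwa [Set.mem_preimage, inv_inv_arrow])
  obtain ⟨c, hc, hcs, -, rfl⟩ := exists_eq_unitCc hf
  have hcγ : c (d γ) ≠ 0 := by
    rw [coe_unitCc, T.unitSec_of_mem c (d_mem_unitSpace γ)] at hγ
    exact left_ne_zero_of_smul hγ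
  have hval : ∀ η, (a * T.unitCc c hc hcs).1 η = c (d η) • a.1 η := fun η => by
    rw [coe_mul, coe_unitCc, T.conv_unitSec_right]
  have hmemW : ∀ η, (a * T.unitCc c hc hcs).1 η ≠ 0 → η ∈ W := fun η hη => by
    by_contra hcon
    rw [hval, eq_zero_of_supportedIn haW hcon, smul_zero] at hη
    exact hη rfl
  -- This is conjugation by a bisection: `a` lives on `W` and `b` on `W⁻¹`, so injectivity of `d` on
  -- `W` leaves only products `κ⁻¹κ`, which are units.
  refine ⟨a * T.unitCc c hc hcs * b, supportedIn_unitSpace_iff.2 fun ζ hζ => ?_, ?_, ?_⟩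
  · rw [coe_mul]
    refine T.conv_eq_zero fun η κ h hη hκ => hζ ?_
    have hκW : inv κ ∈ W := by
      by_contra hcon
      exact hκ (eq_zero_of_supportedIn hbW hcon)
    have hηκ : η = inv κ := hW.2.2 (hmemW η hη) hκW (by rw [d_inv, h.composable])
    rw [← h.comp_eq, hηκ, inv_comp]
    exact d_mem_unitSpace κ
  · rw [hi.map_mul, hi.map_mul]
    exact (hI _ _ (hI _ _ hfI).1).2
  · rw [coe_mul, T.conv_eq_single (isComp_self_inv γ)]
    · refine T.mul_apply_ne_zero _ ?_ hb0
      rw [hval]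
      exact smul_ne_zero hcγ ha0
    · intro η κ h hη _
      exact hW.2.1 (hmemW η hη) hγW (by rw [h.r_eq, r_r])

/-- Near a point where some `c` in the ideal does not vanish, `h c⁻¹ c` is locally one. Two pieces
are joined by `c + c' - c c' = 1 - (1 - c)(1 - c')`, so compactness finishes. -/
theorem exists_unitCc_mem_eq_one (hi : IsBanachCompletion i) {I : Submodule 𝕜 B}
    (hI : ∀ a : B, ∀ b ∈ I, a * b ∈ I ∧ b * a ∈ I)
    (hX : ∀ x ∈ unitSpace G, ∃ f : T.Cc, SupportedIn f (unitSpace G) ∧ i f ∈ I ∧ f.1 x ≠ 0)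
    {K : Set G} (hK : IsCompact K) (hKX : K ⊆ unitSpace G) :
    ∃ (c : G → 𝕜) (hc : Continuous c) (hcs : HasCompactSupport c),
      i (T.unitCc c hc hcs) ∈ I ∧ ∀ x ∈ K, c x = 1 := by
  refine hK.induction_on (p := fun K => ∃ (c : G → 𝕜) (hc : Continuous c)
    (hcs : HasCompactSupport c), i (T.unitCc c hc hcs) ∈ I ∧ ∀ x ∈ K, c x = 1) ?_ ?_ ?_ ?_
  · refine ⟨0, continuous_const, HasCompactSupport.zero, ?_, fun x hx => hx.elim⟩
    have : T.unitCc (0 : G → 𝕜) continuous_const HasCompactSupport.zero = 0 := by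
      refine Subtype.ext (funext fun γ => ?_)
      have := T.norm_unitSec_le (0 : G → 𝕜) γ
      rw [Pi.zero_apply, norm_zero] at this
      exact norm_le_zero_iff.1 this
    rw [this, map_zero]
    exact I.zero_mem
  · rintro s t hst ⟨c, hc, hcs, hcI, hc1⟩
    exact ⟨c, hc, hcs, hcI, fun x hx => hc1 x (hst hx)⟩
  · rintro s t ⟨c, hc, hcs, hcI, hc1⟩ ⟨c', hc', hcs', hcI', hc1'⟩
    have hm : HasCompactSupport fun x => c x * c' x := hcs.mul_right
    have hmc : Continuous fun x => c x * c' x := hc.mul hc'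
    have hs : HasCompactSupport fun x => c x + c' x - c x * c' x := (hcs.add hcs').sub hm
    have hsc : Continuous fun x => c x + c' x - c x * c' x := (hc.add hc').sub hmc
    refine ⟨_, hsc, hs, ?_, ?_⟩
    · have heq : T.unitCc _ hsc hs = T.unitCc c hc hcs +
          T.unitCc c' hc' hcs' - T.unitCc _ hmc hm := by
        refine Subtype.ext (funext fun γ => ?_)
        rw [Submodule.coe_sub, Submodule.coe_add, Pi.sub_apply, Pi.add_apply, coe_unitCc,
          coe_unitCc, coe_unitCc, coe_unitCc]
        by_cases hγ : γ ∈ unitSpace G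
        · simp only [T.unitSec_of_mem _ hγ, add_smul, sub_smul]
        · simp only [T.unitSec_of_notMem _ hγ, add_zero, sub_zero]
      rw [heq, map_sub, map_add]
      refine I.sub_mem (I.add_mem hcI hcI') ?_
      rw [← hi.map_unitCc_mul hc hcs hc' hcs']
      exact (hI _ _ hcI').1
    · rintro x (hx | hx)
      · simp only [hc1 x hx]
        ring
      · simp only [hc1' x hx]
        ring
  · intro x hx
    obtain ⟨f, hf, hfI, hfx⟩ := hX x (hKX hx)
    obtain ⟨c, hc, hcs, -, rfl⟩ := exists_eq_unitCc hf
    have hcx : c x ≠ 0 := by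
      rw [coe_unitCc, T.unitSec_of_mem c (hKX hx)] at hfx
      exact left_ne_zero_of_smul hfx
    have hV : IsOpen {x | c x ≠ 0} := isOpen_ne_fun hc continuous_const
    obtain ⟨D, hD, hDV, hDc⟩ := local_compact_nhds (hV.mem_nhds hcx)
    obtain ⟨h, hh, hhs, hhV, hh1, -⟩ := exists_bump (𝕜 := 𝕜) hDc hV hDV
    -- The inverse is continuous on the support of `h`, which lies where `c ≠ 0`; off that support
    -- the product vanishes locally.
    have hψ : Continuous fun x => h x * (c x)⁻¹ := by
      refine continuous_iff_continuousAt.2 fun z => ?_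
      by_cases hz : z ∈ tsupport h
      · exact hh.continuousAt.mul (hc.continuousAt.inv₀ (hhV hz))
      · refine (continuousAt_const (y := (0 : 𝕜))).congr ?_
        filter_upwards [(isClosed_tsupport h).isOpen_compl.mem_nhds hz] with w hw
        rw [image_eq_zero_of_notMem_tsupport hw, zero_mul]
    have hψs : HasCompactSupport fun x => h x * (c x)⁻¹ := hhs.mul_right
    refine ⟨D, mem_nhdsWithin_of_mem_nhds hD, fun x => h x * (c x)⁻¹ * c x, hψ.mul hc,
      hψs.mul_right, ?_, fun z hz => ?_⟩
    · rw [← hi.map_unitCc_mul hψ hψs hc hcs]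
      exact (hI _ _ hfI).1
    · exact (inv_mul_cancel_right₀ (hDV hz) (h z)).trans (hh1 z hz)

/-- The units seen by functions of the ideal on `X` form a non-empty invariant open set, hence all
of `X`. So for each `a ∈ C_c(G, L)` the ideal has a function equal to one on the ranges of its
support, a left unit for `a`; density gives the rest. -/
theorem isSimpleBanachAlgebra (hG : IsTopologicallyFree G) (hG' : IsMinimalGroupoid G)
    (hi : IsBanachCompletion i) (hr : IsReduced i) : IsSimpleBanachAlgebra 𝕜 B := by
  intro I hIc hI
  obtain ⟨j, hj1, hj2, hj3⟩ := hr.exists_jmap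
  have hj : IsInclusion i j := ⟨hj1, hj2, hj3⟩
  by_cases hbot : I = ⊥
  · exact Or.inl hbot
  right
  obtain ⟨b, hb, hb0⟩ := I.exists_mem_ne_zero_of_ne_bot hbot
  obtain ⟨c, hc, hcs, hcI, y, hy, hcy⟩ := exists_unitCc_mem hG hi hr hj hIc hI hb hb0
  let U : Set G := {x | ∃ f : T.Cc, SupportedIn f (unitSpace G) ∧ i f ∈ I ∧ f.1 x ≠ 0}
  have hUo : IsOpen U := by
    rw [isOpen_iff_mem_nhds]
    rintro x ⟨f, hf, hfI, hfx⟩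
    filter_upwards [(isOpen_lt continuous_const (T.continuous_norm_section f.2.1)).mem_nhds
      (norm_pos_iff.2 hfx)] with z hz
    exact ⟨f, hf, hfI, norm_pos_iff.1 hz⟩
  have hUX : U ⊆ unitSpace G := by
    rintro x ⟨f, hf, hfI, hfx⟩
    by_contra hcon
    exact hfx (eq_zero_of_supportedIn hf hcon)
  have hU : U = unitSpace G := by
    refine (hG' U hUo hUX ?_).resolve_left ?_
    · rintro γ ⟨f, hf, hfI, hfγ⟩
      exact exists_mem_apply_r_ne_zero hi hI hf hfI hfγ
    · refine Set.nonempty_iff_ne_empty.1 ⟨y, T.unitCc c hc hcs, supportedIn_unitCc hc hcs, hcI, ?_⟩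
      rw [coe_unitCc, T.unitSec_of_mem c hy]
      exact smul_ne_zero hcy (norm_ne_zero_iff.1 ((T.norm_one_apply hy).trans_ne one_ne_zero))
  have hmem : ∀ a : T.Cc, i a ∈ I := by
    intro a
    obtain ⟨c, hc, hcs, hcI, hc1⟩ := exists_unitCc_mem_eq_one hi hI
      (fun x hx => by rw [← hU] at hx; exact hx) (IsCompact.image a.2.2 continuous_r)
      (Set.image_subset_iff.2 fun γ _ => r_mem_unitSpace γ)
    have hca : T.unitCc c hc hcs * a = a := by
      refine Subtype.ext (funext fun γ => ?_)
      rw [coe_mul, coe_unitCc, T.conv_unitSec_left]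
      by_cases hγ : a.1 γ = 0
      · rw [hγ, smul_zero]
      · rw [hc1 _ ⟨γ, subset_tsupport _ (by simpa using hγ), rfl⟩, one_smul]
    rw [← hca, hi.map_mul]
    exact (hI _ _ hcI).2
  rw [eq_top_iff]
  intro b _
  have hcl : closure (Set.range i) ⊆ (I : Set B) :=
    closure_minimal (Set.range_subset_iff.2 hmem) hIc
  exact hcl (hi.denseRange b)

end Twist

namespace Twist

variable {𝕜 : Type*} [RCLike 𝕜] {G : Type*} [TopologicalSpace G] [EtaleGroupoid G]
  {L : G → Type*} [∀ γ, NormedAddCommGroup (L γ)] [∀ γ, NormedSpace 𝕜 (L γ)]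
  [TopologicalSpace (TotalSpace 𝕜 L)] {T : Twist 𝕜 L}
  {B : Type*} [NonUnitalNormedRing B] [NormedSpace 𝕜 B]
  {i : T.Cc →ₗ[𝕜] B} {j : B →ₗ[𝕜] T.C0}

/-! ### The diagonal subalgebra -/

theorem IsInclusion.apply_eq_zero_of_mem_diagonal (hj : IsInclusion i j) {b : B}
    (hb : b ∈ diagonal i) {γ : G} (hγ : γ ∉ unitSpace G) : (j b).1 γ = 0 := by
  have hcl : IsClosed {b | (j b).1 γ = 0} :=
    isClosed_eq (hj.continuous_apply γ) continuous_const
  refine closure_minimal ?_ hcl hb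
  rintro _ ⟨f, hf, rfl⟩
  change (j (i f)).1 γ = 0
  rw [hj.map_apply, eq_zero_of_supportedIn hf hγ]

variable [T2Space G]

/-- The image of `C_c(X)` in a completion. -/
def unitSubalgebra (hi : IsBanachCompletion i) : NonUnitalSubalgebra 𝕜 B where
  carrier := i '' {f | SupportedIn f (unitSpace G)}
  zero_mem' := ⟨0, supportedIn_unitSpace_iff.2 fun _ _ => rfl, map_zero i⟩
  add_mem' := by
    rintro _ _ ⟨f, hf, rfl⟩ ⟨g, hg, rfl⟩
    refine ⟨f + g, supportedIn_unitSpace_iff.2 fun γ hγ => ?_, map_add i f g⟩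
    rw [Submodule.coe_add, Pi.add_apply, eq_zero_of_supportedIn hf hγ,
      eq_zero_of_supportedIn hg hγ, add_zero]
  smul_mem' := by
    rintro c _ ⟨f, hf, rfl⟩
    refine ⟨c • f, supportedIn_unitSpace_iff.2 fun γ hγ => ?_, map_smul i c f⟩
    rw [Submodule.coe_smul, Pi.smul_apply, eq_zero_of_supportedIn hf hγ, smul_zero]
  mul_mem' := by
    rintro _ _ ⟨f, hf, rfl⟩ ⟨g, hg, rfl⟩
    obtain ⟨c, hc, hcs, -, rfl⟩ := exists_eq_unitCc hf
    obtain ⟨c', hc', hcs', -, rfl⟩ := exists_eq_unitCc hg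
    exact ⟨_, supportedIn_unitCc (hc.mul hc') hcs.mul_right, (hi.map_unitCc_mul _ _ _ _).symm⟩

theorem mul_comm_of_mem_diagonal (hi : IsBanachCompletion i) {a b : B} (ha : a ∈ diagonal i)
    (hb : b ∈ diagonal i) : a * b = b * a := by
  have h1 : i '' {f | SupportedIn f (unitSpace G)} ⊆
      Set.centralizer (i '' {f | SupportedIn f (unitSpace G)}) := by
    rintro _ ⟨f, hf, rfl⟩
    rw [Set.mem_centralizer_iff]
    rintro _ ⟨g, hg, rfl⟩
    obtain ⟨c, hc, hcs, -, rfl⟩ := exists_eq_unitCc hf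
    obtain ⟨c', hc', hcs', -, rfl⟩ := exists_eq_unitCc hg
    rw [hi.map_unitCc_mul, hi.map_unitCc_mul]
    simp only [mul_comm]
  have h2 := closure_minimal h1 (Set.isClosed_centralizer _)
  have h3 : i '' {f | SupportedIn f (unitSpace G)} ⊆ Set.centralizer (diagonal i) := by
    intro x hx
    rw [Set.mem_centralizer_iff]
    intro y hy
    exact (Set.mem_centralizer_iff.1 (h2 hy) x hx).symm
  exact (Set.mem_centralizer_iff.1 (closure_minimal h3 (Set.isClosed_centralizer _) ha) b hb).symm

variable [LocallyCompactSpace G]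

theorem exists_unitCc_norm_sub_le {s : T.C0} (hs : ∀ γ, γ ∉ unitSpace G → s.1 γ = 0) {ε : ℝ}
    (hε : 0 < ε) : ∃ f : T.Cc, SupportedIn f (unitSpace G) ∧ ∀ γ, ‖s.1 γ - f.1 γ‖ ≤ ε := by
  obtain ⟨c, hc0, hsc⟩ := T.exists_eq_unitSec hs
  have hc : Continuous c := T.continuous_of_unitSec hc0 (hsc ▸ s.2.1)
  obtain ⟨h, hh, hhs, -, hh1, hhn⟩ := exists_bump (𝕜 := 𝕜) (s.2.2 (ε / 2) (half_pos hε))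
    isOpen_univ (Set.subset_univ _)
  have hhc : Continuous fun x => h x * c x := hh.mul hc
  refine ⟨T.unitCc _ hhc hhs.mul_right, supportedIn_unitCc _ _, fun γ => ?_⟩
  rw [coe_unitCc]
  by_cases hγ : γ ∈ unitSpace G
  · have hsγ : s.1 γ = c γ • T.one γ hγ := by rw [hsc, T.unitSec_of_mem c hγ]
    by_cases hγK : ε / 2 ≤ ‖s.1 γ‖
    · rw [T.unitSec_of_mem _ hγ, hh1 γ hγK, _root_.one_mul, hsγ, sub_self, norm_zero]
      exact hε.le
    · rw [T.unitSec_of_mem _ hγ, mul_smul, ← hsγ]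
      refine (norm_sub_le _ _).trans ?_
      rw [norm_smul]
      nlinarith [hhn γ, norm_nonneg (s.1 γ), norm_nonneg (h γ)]
  · rw [T.unitSec_of_notMem _ hγ, hs γ hγ, sub_zero, norm_zero]
    exact hε.le

/-- The section `j b` is a uniform limit of elements of `C_c(X)`. As the norm of `B` is the supremum
norm there, they converge in `B`; the limit has the same image under `j` as `b`, hence equals `b`.
-/
theorem IsInclusion.mem_diagonal (hj : IsInclusion i j) (hi : IsBanachCompletion i)
    (hr : IsReduced i) {b : B} (hb : ∀ γ, γ ∉ unitSpace G → (j b).1 γ = 0) : b ∈ diagonal i := by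
  have := hi.completeSpace
  have h : ∀ n : ℕ, ∃ f : T.Cc, SupportedIn f (unitSpace G) ∧
      ∀ γ, ‖(j b).1 γ - f.1 γ‖ ≤ 1 / ((n : ℝ) + 1) := fun n =>
    exists_unitCc_norm_sub_le hb Nat.one_div_pos_of_nat
  choose f hfX hf using h
  have hcauchy : CauchySeq fun n => i (f n) := by
    refine cauchySeq_of_le_tendsto_0 (fun n : ℕ => 1 / ((n : ℝ) + 1) + 1 / ((n : ℝ) + 1))
      (fun n m N hn hm => ?_) ?_
    · rw [dist_eq_norm, ← map_sub, hr.isometric_unitSpace]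
      · refine supNorm_le (by positivity) fun γ => ?_
        have h1 : ‖(f n).1 γ - (f m).1 γ‖ ≤ ‖(j b).1 γ - (f n).1 γ‖ + ‖(j b).1 γ - (f m).1 γ‖ := by
          rw [norm_sub_rev ((j b).1 γ) ((f n).1 γ)]
          exact norm_sub_le_norm_sub_add_norm_sub _ _ _
        exact h1.trans (add_le_add ((hf n γ).trans (Nat.one_div_le_one_div hn))
          ((hf m γ).trans (Nat.one_div_le_one_div hm)))
      · rw [supportedIn_unitSpace_iff]
        intro γ hγ
        rw [Submodule.coe_sub, Pi.sub_apply, eq_zero_of_supportedIn (hfX n) hγ,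
          eq_zero_of_supportedIn (hfX m) hγ, sub_zero]
    · have := (tendsto_one_div_add_atTop_nhds_zero_nat (𝕜 := ℝ)).add
        (tendsto_one_div_add_atTop_nhds_zero_nat (𝕜 := ℝ))
      rwa [add_zero] at this
  obtain ⟨b', hb'⟩ := cauchySeq_tendsto_of_complete hcauchy
  have hbb' : b' = b := by
    refine hj.injective (Subtype.ext (funext fun γ => ?_))
    refine tendsto_nhds_unique (((hj.continuous_apply γ).tendsto b').comp hb') ?_
    simp only [Function.comp_def, hj.map_apply]
    rw [tendsto_iff_norm_sub_tendsto_zero]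
    refine squeeze_zero (fun _ => norm_nonneg _) (fun n => ?_)
      (tendsto_one_div_add_atTop_nhds_zero_nat (𝕜 := ℝ))
    rw [norm_sub_rev]
    exact hf n γ
  rw [← hbb']
  exact mem_closure_of_tendsto hb' (Eventually.of_forall fun n => ⟨f n, hfX n, rfl⟩)

/-- If `r γ ≠ d γ`, a function `h` on units with `h (r γ) = 1` and `h (d γ) = 0` separates the two
products at `γ`: one has value `j b γ`, the other `0`. Commuting elements thus live on the isotropy,
and on `X` by topological freeness. -/
theorem isMaximalAbelian_diagonal (hG : IsTopologicallyFree G) (hi : IsBanachCompletion i)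
    (hr : IsReduced i) : IsMaximalAbelian 𝕜 (diagonal i) := by
  obtain ⟨j, hj1, hj2, hj3⟩ := hr.exists_jmap
  have hj : IsInclusion i j := ⟨hj1, hj2, hj3⟩
  refine ⟨⟨⟨(unitSubalgebra hi).topologicalClosure, rfl⟩,
    fun a ha b hb => mul_comm_of_mem_diagonal hi ha hb⟩, ?_⟩
  rintro A ⟨-, hA⟩ hdA b hb
  refine hj.mem_diagonal hi hr ?_
  have hiso : ∀ γ, (j b).1 γ ≠ 0 → r γ = d γ := by
    intro γ hγ
    by_contra hne
    obtain ⟨h, hh, hhs, hhU, hh1, -⟩ := exists_bump (𝕜 := 𝕜) (K := {r γ}) isCompact_singleton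
      (isOpen_compl_singleton (x := d γ)) (Set.singleton_subset_iff.2 hne)
    have hcomm := hA _ (hdA (subset_closure ⟨_, supportedIn_unitCc (T := T) hh hhs, rfl⟩)) b hb
    have h1 := hj.apply_mul_left hi (T.unitCc h hh hhs) b γ
    rw [hcomm, hj.apply_mul_right hi, coe_unitCc, T.conv_unitSec_left, T.conv_unitSec_right,
      hh1 _ rfl, one_smul,
      image_eq_zero_of_notMem_tsupport (fun h2 => hhU h2 rfl), zero_smul] at h1
    exact hγ h1.symm
  have hV : IsOpen ({γ | 0 < ‖(j b).1 γ‖} ∩ (unitSpace G)ᶜ) :=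
    (isOpen_lt continuous_const (T.continuous_norm_section (j b).2.1)).inter
      (isClosed_unitSpace G).isOpen_compl
  have hempty := hG _ hV Set.inter_subset_right fun γ hγ => hiso γ (norm_pos_iff.1 hγ.1)
  intro γ hγ
  by_contra hne
  exact Set.eq_empty_iff_forall_notMem.1 hempty γ ⟨norm_pos_iff.2 hne, hγ⟩

/-! ### From the algebra back to the groupoid -/

/-- For `a` supported where `r = d`, left and right multiplication by `C_c(X)` agree, so adjoining
`i a` to the diagonal keeps it commutative. Maximality then makes `a` vanish off the unit space. -/
theorem isTopologicallyFree_of_isMaximalAbelian [IsScalarTower 𝕜 B B] [SMulCommClass 𝕜 B B]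
    (hi : IsBanachCompletion i) (hr : IsReduced i) (hd : IsMaximalAbelian 𝕜 (diagonal i)) :
    IsTopologicallyFree G := by
  obtain ⟨j, hj1, hj2, hj3⟩ := hr.exists_jmap
  have hj : IsInclusion i j := ⟨hj1, hj2, hj3⟩
  intro V hV hVX hVrd
  by_contra hne
  obtain ⟨γ, hγ⟩ := Set.nonempty_iff_ne_empty.2 hne
  obtain ⟨a, haV, ha0⟩ := T.exists_mem_Cc hV hγ
  have hcomm : ∀ b ∈ diagonal i, b * i a = i a * b := by
    have h1 : i '' {f | SupportedIn f (unitSpace G)} ⊆ Set.centralizer {i a} := by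
      rintro _ ⟨f, hf, rfl⟩
      rw [Set.mem_centralizer_iff]
      rintro _ rfl
      obtain ⟨c, hc, hcs, -, rfl⟩ := exists_eq_unitCc hf
      rw [← hi.map_mul, ← hi.map_mul]
      refine congrArg i (Subtype.ext (funext fun η => ?_))
      rw [coe_mul, coe_mul, coe_unitCc, T.conv_unitSec_left, T.conv_unitSec_right]
      by_cases hη : η ∈ V
      · rw [hVrd η hη]
      · rw [eq_zero_of_supportedIn haV hη, smul_zero, smul_zero]
    intro b hb
    exact (Set.mem_centralizer_iff.1
      (closure_minimal h1 (Set.isClosed_centralizer _) hb) _ rfl).symm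
  let A := NonUnitalAlgebra.adjoin 𝕜 (insert (i a) (diagonal i))
  have hAc : IsMulCommutative A := by
    refine NonUnitalAlgebra.isMulCommutative_adjoin 𝕜 ?_
    rintro x (rfl | hx) y (rfl | hy)
    · rfl
    · exact (hcomm y hy).symm
    · exact hcomm x hx
    · exact mul_comm_of_mem_diagonal hi hx hy
  have hsub : insert (i a) (diagonal i) ⊆ (A : Set B) := NonUnitalAlgebra.subset_adjoin 𝕜
  have hmem : i a ∈ diagonal i :=
    hd.2 ⟨⟨A, rfl⟩, fun x hx y hy => setLike_mul_comm (s := A) hx hy⟩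
      ((Set.subset_insert _ _).trans hsub) (hsub (Set.mem_insert _ _))
  have h0 := hj.apply_eq_zero_of_mem_diagonal hmem (hVX hγ)
  rw [hj.map_apply] at h0
  exact ha0 h0

/-- The ideal consists of the elements supported on arrows with range in `U`. Since `C_c(G, L)` is
dense and the ideal is closed, only products with `C_c(G, L)` are checked; invariance of `U` enters
for left products. -/
theorem isMinimalGroupoid_of_isSimple (hi : IsBanachCompletion i) (hr : IsReduced i)
    (hB : IsSimpleBanachAlgebra 𝕜 B) : IsMinimalGroupoid G := by
  obtain ⟨j, hj1, hj2, hj3⟩ := hr.exists_jmap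
  have hj : IsInclusion i j := ⟨hj1, hj2, hj3⟩
  intro U hUo hUX hU
  have hU' : ∀ γ, r γ ∈ U → d γ ∈ U := fun γ hγ => by
    have h := hU (inv γ)
    rw [d_inv, r_inv] at h
    exact h hγ
  let I : Submodule 𝕜 B :=
    { carrier := {b | ∀ γ, r γ ∉ U → (j b).1 γ = 0}
      zero_mem' := fun γ _ => by rw [map_zero]; rfl
      add_mem' := fun {a b} ha hb γ hγ => by
        rw [map_add, Submodule.coe_add, Pi.add_apply, ha γ hγ, hb γ hγ, add_zero]
      smul_mem' := fun c b hb γ hγ => by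
        rw [map_smul, Submodule.coe_smul, Pi.smul_apply, hb γ hγ, smul_zero] }
  have hIc : IsClosed (I : Set B) := by
    have : (I : Set B) = ⋂ (γ : G) (_ : r γ ∉ U), {b | (j b).1 γ = 0} := by
      ext b
      simp only [Set.mem_iInter]
      rfl
    rw [this]
    exact isClosed_iInter fun γ => isClosed_iInter fun _ =>
      isClosed_eq (hj.continuous_apply γ) continuous_const
  have hI : ∀ a : B, ∀ b ∈ I, a * b ∈ I ∧ b * a ∈ I := by
    intro a b hb
    refine ⟨?_, ?_⟩
    · refine hi.denseRange.induction_on (p := fun a => a * b ∈ I) a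
        (hIc.preimage (continuous_id.mul continuous_const)) fun f γ hγ => ?_
      rw [hj.apply_mul_left hi]
      refine T.conv_eq_zero fun η κ h _ hκ => hκ (hb κ fun hκU => hγ ?_)
      rw [← h.r_eq]
      exact hU η (by rwa [h.composable])
    · refine hi.denseRange.induction_on (p := fun a => b * a ∈ I) a
        (hIc.preimage (continuous_const.mul continuous_id)) fun f γ hγ => ?_
      rw [hj.apply_mul_right hi]
      exact T.conv_eq_zero fun η κ h hη _ => hη (hb η (by rwa [h.r_eq]))
  rcases hB I hIc hI with hbot | htop
  · left
    by_contra hne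
    obtain ⟨x, hx⟩ := Set.nonempty_iff_ne_empty.2 hne
    obtain ⟨a, haU, ha0⟩ := T.exists_mem_Cc hUo hx
    have hmem : i a ∈ I := by
      intro γ hγ
      rw [hj.map_apply]
      refine eq_zero_of_supportedIn haU fun hγU => hγ ?_
      rwa [r_eq_of_mem_unitSpace (hUX hγU)]
    rw [hbot, Submodule.mem_bot] at hmem
    apply ha0
    rw [← hj.map_apply, hmem, map_zero]
    rfl
  · right
    refine Set.Subset.antisymm hUX fun x hx => ?_
    by_contra hxU
    obtain ⟨a, -, ha0⟩ := T.exists_mem_Cc isOpen_univ (Set.mem_univ x)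
    have hmem : i a ∈ I := htop ▸ Submodule.mem_top
    have h0 := hmem x (by rwa [r_eq_of_mem_unitSpace hx])
    rw [hj.map_apply] at h0
    exact ha0 h0

/-- A reduced completion is simple with `C_0(X)` maximal abelian if and only if the groupoid is
topologically free and minimal. -/
theorem isSimple_and_isMaximalAbelian_iff [IsScalarTower 𝕜 B B] [SMulCommClass 𝕜 B B]
    (hi : IsBanachCompletion i) (hr : IsReduced i) :
    (IsSimpleBanachAlgebra 𝕜 B ∧ IsMaximalAbelian 𝕜 (diagonal i)) ↔
      (IsTopologicallyFree G ∧ IsMinimalGroupoid G) :=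
  ⟨fun h => ⟨isTopologicallyFree_of_isMaximalAbelian hi hr h.2,
    isMinimalGroupoid_of_isSimple hi hr h.1⟩,
  fun h => ⟨isSimpleBanachAlgebra h.1 h.2 hi hr, isMaximalAbelian_diagonal h.1 hi hr⟩⟩

end Twist

/-! ### Pointwise domination of summable sections -/

theorem lp.exists_norm_le_of_norm_apply_le (𝕜 : Type*) [RCLike 𝕜] {α : Type*} {L : α → Type*}
    [∀ γ, NormedAddCommGroup (L γ)] [∀ γ, NormedSpace 𝕜 (L γ)] {p : ℝ≥0∞} (hp : p ≠ 0)
    (ξ : lp L p) {u : ∀ γ, L γ}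
    {C : ℝ} (hC : 0 ≤ C) (hu : ∀ γ, ‖u γ‖ ≤ C * ‖ξ γ‖) :
    ∃ hm : Memℓp u p, ‖(⟨u, hm⟩ : lp L p)‖ ≤ C * ‖ξ‖ := by
  have h1 : ∀ γ, ‖u γ‖ ≤ ‖((C : 𝕜) • ξ : lp L p) γ‖ := fun γ => by
    rw [lp.coeFn_smul, Pi.smul_apply, norm_smul, RCLike.norm_ofReal, abs_of_nonneg hC]
    exact hu γ
  have hm : Memℓp u p := (lp.memℓp ((C : 𝕜) • ξ : lp L p)).mono' h1
  refine ⟨hm, (lp.norm_mono hp (x := (⟨u, hm⟩ : lp L p)) h1).trans ?_⟩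
  refine (lp.norm_const_smul_le hp _ _).trans ?_
  rw [RCLike.norm_ofReal, abs_of_nonneg hC]

namespace Twist

variable {𝕜 : Type*} [RCLike 𝕜] {G : Type*} [TopologicalSpace G] [EtaleGroupoid G]
  {L : G → Type*} [∀ γ, NormedAddCommGroup (L γ)] [∀ γ, NormedSpace 𝕜 (L γ)]
  [TopologicalSpace (TotalSpace 𝕜 L)] {T : Twist 𝕜 L} [T2Space G]
  {B : Type*} [NonUnitalNormedRing B] [NormedSpace 𝕜 B]
  {i : T.Cc →ₗ[𝕜] B} {P : Set ℝ≥0∞}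

/-! ### Reduced `L^P`-operator algebras -/

theorem IsReducedLpAlgebra.exists_norm_conv_le (h : IsReducedLpAlgebra P i) {p : ℝ≥0∞}
    (hp : p ∈ P) (f : T.Cc) (ξ : lp L p) :
    ∃ hm : Memℓp (T.conv f.1 ξ) p, ‖(⟨T.conv f.1 ξ, hm⟩ : lp L p)‖ ≤ ‖i f‖ * ‖ξ‖ := by
  have hle : reducedLpNorm p f ≤ ENNReal.ofReal ‖i f‖ := by
    rw [h.norm_eq]
    exact le_iSup₂ (f := fun p (_ : p ∈ P) => reducedLpNorm p f) p hp
  -- The infimum defining the norm is only approached, so the bound is first proved with an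
  -- arbitrary excess `ε`.
  have key : ∀ ε : ℝ, 0 < ε → ∃ hm : Memℓp (T.conv f.1 ξ) p,
      ‖(⟨T.conv f.1 ξ, hm⟩ : lp L p)‖ ≤ (‖i f‖ + ε) * ‖ξ‖ := by
    intro ε hε
    have hlt : reducedLpNorm p f < ENNReal.ofReal (‖i f‖ + ε) :=
      hle.trans_lt ((ENNReal.ofReal_lt_ofReal_iff (by positivity)).2 (by linarith))
    obtain ⟨C, hC, hCε⟩ := sInf_lt_iff.1 hlt
    obtain ⟨hm, hmC⟩ := hC ξ
    refine ⟨hm, ?_⟩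
    have h1 := hmC.trans (mul_le_mul_left hCε.le (ENNReal.ofReal ‖ξ‖))
    rw [← ENNReal.ofReal_mul (by positivity)] at h1
    exact (ENNReal.ofReal_le_ofReal_iff (mul_nonneg (by positivity) (lp.norm_nonneg' ξ))).1 h1
  obtain ⟨hm, -⟩ := key 1 one_pos
  refine ⟨hm, ?_⟩
  have hlim : Tendsto (fun ε : ℝ => (‖i f‖ + ε) * ‖ξ‖) (𝓝[>] 0) (𝓝 ((‖i f‖ + 0) * ‖ξ‖)) := by
    refine Tendsto.mono_left ?_ nhdsWithin_le_nhds
    exact ((continuous_const.add continuous_id).mul continuous_const).tendsto 0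
  rw [add_zero] at hlim
  refine ge_of_tendsto hlim ?_
  filter_upwards [self_mem_nhdsWithin] with ε hε
  exact (key ε hε).2

theorem IsReducedLpAlgebra.norm_le (h : IsReducedLpAlgebra P i) {f : T.Cc} {C : ℝ} (hC : 0 ≤ C)
    (H : ∀ p ∈ P, ∀ ξ : lp L p, ∃ hm : Memℓp (T.conv f.1 ξ) p,
      ‖(⟨T.conv f.1 ξ, hm⟩ : lp L p)‖ ≤ C * ‖ξ‖) : ‖i f‖ ≤ C := by
  rw [← ENNReal.ofReal_le_ofReal_iff hC, h.norm_eq]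
  refine iSup₂_le fun p hp => sInf_le fun ξ => ?_
  obtain ⟨hm, hle⟩ := H p hp ξ
  refine ⟨hm, ?_⟩
  rw [← ENNReal.ofReal_mul hC]
  exact ENNReal.ofReal_le_ofReal hle

/-- Convolution with the point mass at the unit `d γ`, a vector of norm one in each `ℓ^p`, has value
`f γ` at `γ`. -/
theorem IsReducedLpAlgebra.norm_apply_le (h : IsReducedLpAlgebra P i) (hP : P.Nonempty)
    (hP1 : ∀ p ∈ P, 1 ≤ p) (f : T.Cc) (γ : G) : ‖f.1 γ‖ ≤ ‖i f‖ := by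
  classical
  obtain ⟨p, hp⟩ := hP
  have hp0 : 0 < p := one_pos.trans_le (hP1 p hp)
  let ξ : lp L p := lp.single p (d γ) (T.one (d γ) (d_mem_unitSpace γ))
  have hξ : (ξ : ∀ γ, L γ) = T.unitSec (Pi.single (d γ) 1) := by
    funext η
    by_cases hη : η = d γ
    · subst hη
      rw [T.unitSec_of_mem _ (d_mem_unitSpace γ), Pi.single_eq_same, one_smul]
      exact lp.single_apply_self _ _ _
    · have h1 : (ξ : ∀ γ, L γ) η = 0 := lp.single_apply_ne _ _ _ hη
      have h2 := T.norm_unitSec_le (Pi.single (d γ) (1 : 𝕜)) η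
      rw [Pi.single_eq_of_ne hη, norm_zero] at h2
      rw [h1, norm_le_zero_iff.1 h2]
  have hξn : ‖ξ‖ = 1 := (lp.norm_single hp0 _ _).trans (T.norm_one_apply _)
  obtain ⟨hm, hle⟩ := h.exists_norm_conv_le hp f ξ
  rw [hξn, _root_.mul_one] at hle
  refine le_trans ?_ hle
  have h1 := lp.norm_apply_le_norm hp0.ne' (⟨T.conv f.1 ξ, hm⟩ : lp L p) γ
  change ‖T.conv f.1 ξ γ‖ ≤ _ at h1
  have h2 : T.conv f.1 ξ γ = f.1 γ := by
    rw [hξ, T.conv_unitSec_right, Pi.single_eq_same, one_smul]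
  rwa [h2] at h1

/-- An element of `C_c(X)` acts by pointwise multiplication by `c (r γ)`. -/
theorem IsReducedLpAlgebra.isometric (h : IsReducedLpAlgebra P i) (hP : P.Nonempty)
    (hP1 : ∀ p ∈ P, 1 ≤ p) {f : T.Cc} (hf : SupportedIn f (unitSpace G)) : ‖i f‖ = supNorm f := by
  refine le_antisymm (h.norm_le (supNorm_nonneg f) fun p hp ξ => ?_)
    (supNorm_le (norm_nonneg _) (h.norm_apply_le hP hP1 f))
  refine lp.exists_norm_le_of_norm_apply_le 𝕜 (one_pos.trans_le (hP1 p hp)).ne' ξ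
    (supNorm_nonneg f) fun γ => ?_
  obtain ⟨c, hc, hcs, -, rfl⟩ := exists_eq_unitCc hf
  rw [coe_unitCc, T.conv_unitSec_left, norm_smul]
  refine mul_le_mul_of_nonneg_right ?_ (norm_nonneg _)
  rw [← T.norm_unitSec_of_mem c (r_mem_unitSpace γ)]
  exact norm_le_supNorm (T.unitCc c hc hcs) _

/-- Left convolution operators depend lower semicontinuously, in norm, on pointwise limits. -/
theorem IsReducedLpAlgebra.norm_le_of_tendsto (h : IsReducedLpAlgebra P i)
    (hP1 : ∀ p ∈ P, 1 ≤ p) {f : T.Cc} {F : ℕ → T.Cc} {C : ℝ} (hC : 0 ≤ C)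
    (hF : ∀ᶠ n in atTop, ‖i (F n)‖ ≤ C)
    (hlim : ∀ γ, Tendsto (fun n => (F n).1 γ) atTop (𝓝 (f.1 γ))) : ‖i f‖ ≤ C := by
  classical
  refine h.norm_le hC fun p hp ξ => ?_
  have : Fact (1 ≤ p) := ⟨hP1 p hp⟩
  have hp0 : p ≠ 0 := (one_pos.trans_le (hP1 p hp)).ne'
  -- For finitely supported `ξ` the convolutions are finite sums and converge pointwise; the `ℓ^p`
  -- norm is lower semicontinuous for pointwise limits.
  have hfin : ∀ ξ : lp L p, {κ | ξ κ ≠ 0}.Finite → ∀ hm : Memℓp (T.conv f.1 ξ) p,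
      ‖(⟨T.conv f.1 ξ, hm⟩ : lp L p)‖ ≤ C * ‖ξ‖ := by
    intro ξ hξ hm
    choose hmem hle using fun n => h.exists_norm_conv_le hp (F n) ξ
    refine lp.norm_le_of_tendsto (l := atTop) (F := fun n => ⟨T.conv (F n).1 ξ, hmem n⟩) ?_ ?_
    · filter_upwards [hF] with n hn
      exact (hle n).trans (mul_le_mul_of_nonneg_right hn (norm_nonneg ξ))
    · exact tendsto_pi_nhds.2 fun γ => T.tendsto_conv_left (hξ.subset fun κ hκ => hκ.2) hlim
  obtain ⟨hm, -⟩ := h.exists_norm_conv_le hp f ξ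
  refine ⟨hm, ?_⟩
  -- Truncations need not approximate `ξ` in norm when `p = ∞`. Pointwise convergence of `f * η s`
  -- suffices, and holds since `f` has finite support on each range fibre.
  have htr : ∀ s : Finset G, ∃ η : lp L p, (∀ γ, η γ = if γ ∈ s then ξ γ else 0) ∧ ‖η‖ ≤ ‖ξ‖ := by
    intro s
    obtain ⟨hm, hle⟩ := lp.exists_norm_le_of_norm_apply_le 𝕜 hp0 ξ
      (u := fun γ => if γ ∈ s then ξ γ else 0) zero_le_one fun γ => by
        rw [_root_.one_mul]
        split_ifs
        · exact le_rfl
        · rw [norm_zero]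
          exact norm_nonneg _
    exact ⟨⟨_, hm⟩, fun γ => rfl, by rwa [_root_.one_mul] at hle⟩
  choose η hη hηn using htr
  choose hmem hle using fun s => h.exists_norm_conv_le hp f (η s)
  refine lp.norm_le_of_tendsto (l := atTop) (F := fun s => ⟨T.conv f.1 (η s), hmem s⟩)
    (Eventually.of_forall fun s => ?_) ?_
  · refine (hfin (η s) (s.finite_toSet.subset fun κ hκ => ?_) (hmem s)).trans
      (mul_le_mul_of_nonneg_left (hηn s) hC)
    by_contra hcon
    exact hκ ((hη s κ).trans (if_neg hcon))
  · refine tendsto_pi_nhds.2 fun γ => T.tendsto_conv_right (finite_r_eq f _) fun κ => ?_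
    refine tendsto_const_nhds.congr' ?_
    filter_upwards [eventually_ge_atTop {κ}] with s hs
    rw [hη, if_pos (Finset.singleton_subset_iff.1 hs)]

/-! ### Extension of the inclusion and its injectivity -/

section Limits

variable [LocallyCompactSpace G]

/-- Sections that are uniform limits of elements of `C_c(G, L)` belong to `C_0(G, L)`. -/
theorem mem_C0_of_forall_exists_norm_sub_lt {s : ∀ γ, L γ}
    (hs : ∀ ε : ℝ, 0 < ε → ∃ f : T.Cc, ∀ γ, ‖s γ - f.1 γ‖ < ε) : s ∈ T.C0 := by
  have hcont : Continuous (fun γ => (⟨γ, s γ⟩ : TotalSpace 𝕜 L)) := by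
    refine continuous_iff_continuousAt.2 fun γ₀ => ?_
    obtain ⟨a, -, ha0⟩ := T.exists_mem_Cc isOpen_univ (Set.mem_univ γ₀)
    obtain ⟨c, hc⟩ := T.isLineBundle.exists_smul_eq ha0 (s γ₀)
    refine T.isLineBundle.continuousAt_of_tendsto_norm_sub a.2.1.continuousAt ha0 hc ?_
    rw [Metric.tendsto_nhds]
    intro ε hε
    obtain ⟨f, hf⟩ := hs (ε / 2) (half_pos hε)
    have hcts : Continuous fun γ => ‖(f - c • a).1 γ‖ := T.continuous_norm_section (f - c • a).2.1
    have h0 : ‖(f - c • a).1 γ₀‖ < ε / 2 := by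
      change ‖f.1 γ₀ - c • a.1 γ₀‖ < ε / 2
      rw [hc, norm_sub_rev]
      exact hf γ₀
    filter_upwards [(isOpen_lt hcts continuous_const).mem_nhds h0] with γ hγ
    change ‖f.1 γ - c • a.1 γ‖ < ε / 2 at hγ
    rw [Real.dist_eq, sub_zero, abs_of_nonneg (norm_nonneg _)]
    calc ‖s γ - c • a.1 γ‖ ≤ ‖s γ - f.1 γ‖ + ‖f.1 γ - c • a.1 γ‖ :=
          norm_sub_le_norm_sub_add_norm_sub _ _ _
      _ < ε := by linarith [hf γ]
  refine ⟨hcont, fun ε hε => ?_⟩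
  obtain ⟨f, hf⟩ := hs ε hε
  refine IsCompact.of_isClosed_subset f.2.2
    (isClosed_le continuous_const (T.continuous_norm_section hcont)) fun γ hγ => ?_
  by_contra hcon
  have h0 : f.1 γ = 0 := norm_eq_zero.1
    (image_eq_zero_of_notMem_tsupport (f := fun γ => ‖f.1 γ‖) hcon)
  have h1 := hf γ
  rw [h0, sub_zero] at h1
  exact absurd hγ (not_le.2 h1)

/-- The contractive extension to a completion of the inclusion of `C_c(G, L)` in `C_0(G, L)`. -/
theorem exists_extension (hi : IsBanachCompletion i) (hn : ∀ (f : T.Cc) γ, ‖f.1 γ‖ ≤ ‖i f‖) :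
    ∃ j : B →ₗ[𝕜] T.C0, (∀ b γ, ‖(j b).1 γ‖ ≤ ‖b‖) ∧ ∀ f : T.Cc, (j (i f)).1 = f.1 := by
  have hfd : ∀ γ, FiniteDimensional 𝕜 (L γ) := fun γ =>
    FiniteDimensional.of_finrank_pos (by rw [T.isLineBundle.finrank_fiber]; exact one_pos)
  have hcs : ∀ γ, CompleteSpace (L γ) := fun γ => FiniteDimensional.complete 𝕜 (L γ)
  let ev : ∀ γ, T.Cc →ₗ[𝕜] L γ := fun γ =>
    (LinearMap.proj γ : (∀ γ, L γ) →ₗ[𝕜] L γ) ∘ₗ T.Cc.subtype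
  have hev : ∀ γ f, ‖ev γ f‖ ≤ 1 * ‖i f‖ := fun γ f => by
    rw [_root_.one_mul]
    exact hn f γ
  -- Evaluation extends fibre by fibre, the fibres being finite-dimensional and so complete. The
  -- bounds are uniform in `γ`, which makes the resulting section a uniform limit of elements of
  -- `C_c(G, L)`.
  let J : ∀ γ, B →L[𝕜] L γ := fun γ => (ev γ).extendOfNorm i
  have hJ : ∀ γ b, ‖J γ b‖ ≤ ‖b‖ := fun γ b =>
    (LinearMap.norm_extendOfNorm_apply_le hi.denseRange 1 (hev γ) b).trans_eq (_root_.one_mul _)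
  have hJi : ∀ γ f, J γ (i f) = f.1 γ := fun γ f =>
    LinearMap.extendOfNorm_eq hi.denseRange ⟨1, hev γ⟩ f
  have hmem : ∀ b, (fun γ => J γ b) ∈ T.C0 := fun b =>
    mem_C0_of_forall_exists_norm_sub_lt fun ε hε => by
      obtain ⟨f, hf⟩ := hi.exists_norm_sub_lt b hε
      refine ⟨f, fun γ => ?_⟩
      rw [← hJi, ← map_sub]
      exact (hJ γ _).trans_lt hf
  refine ⟨(LinearMap.pi fun γ => (J γ : B →ₗ[𝕜] L γ)).codRestrict T.C0 hmem,
    fun b γ => hJ γ b, fun f => funext fun γ => hJi γ f⟩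

/-- Reduced `L^P`-operator algebras are reduced completions. -/
theorem IsReducedLpAlgebra.isReduced (h : IsReducedLpAlgebra P i) (hP : P.Nonempty)
    (hP1 : ∀ p ∈ P, 1 ≤ p) : IsReduced i := by
  have hi := h.toIsBanachCompletion
  refine ⟨fun f hf => h.isometric hP hP1 hf, ?_⟩
  obtain ⟨j, hj1, hj2⟩ := exists_extension hi (h.norm_apply_le hP hP1)
  refine ⟨j, hj1, hj2, (injective_iff_map_eq_zero j).2 fun b hb => ?_⟩
  -- Let `j b = 0`, let `f` be `ε`-close to `b`, and let `g n → b` in norm. Then `g n → 0`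
  -- pointwise, so `f - g n → f` pointwise with norms eventually at most `2ε`. Lower semicontinuity
  -- gives `‖i f‖ ≤ 2ε`, hence `‖b‖ ≤ 3ε`.
  have hsmall : ∀ ε : ℝ, 0 < ε → ‖b‖ ≤ 3 * ε := by
    intro ε hε
    obtain ⟨f, hf⟩ := hi.exists_norm_sub_lt b hε
    choose g hg using fun n : ℕ => hi.exists_norm_sub_lt b
      (Nat.one_div_pos_of_nat (α := ℝ) (n := n))
    have hlim : ∀ γ, Tendsto (fun n => (f - g n).1 γ) atTop (𝓝 (f.1 γ)) := by
      intro γ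
      have hg0 : Tendsto (fun n => (g n).1 γ) atTop (𝓝 0) := by
        refine squeeze_zero_norm (fun n => ?_) (tendsto_one_div_add_atTop_nhds_zero_nat (𝕜 := ℝ))
        have h1 := hj1 (b - i (g n)) γ
        rw [map_sub, hb, zero_sub] at h1
        change ‖-(j (i (g n))).1 γ‖ ≤ _ at h1
        rw [hj2, norm_neg] at h1
        exact h1.trans (hg n).le
      have := (tendsto_const_nhds (x := f.1 γ)).sub hg0
      rwa [sub_zero] at this
    have hfle : ‖i f‖ ≤ 2 * ε := by
      refine h.norm_le_of_tendsto hP1 (by positivity) ?_ hlim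
      filter_upwards [(tendsto_one_div_add_atTop_nhds_zero_nat (𝕜 := ℝ)).eventually
        (gt_mem_nhds hε)] with n hn
      have h1 : i (f - g n) = (b - i (g n)) - (b - i f) := by
        rw [map_sub]
        abel
      rw [h1]
      linarith [norm_sub_le (b - i (g n)) (b - i f), hg n]
    have h2 := norm_sub_norm_le b (i f)
    linarith
  refine norm_le_zero_iff.1 (le_of_forall_pos_le_add fun ε hε => ?_)
  have := hsmall (ε / 3) (by positivity)
  linarith

end Limits

end Twist

/-! ### Topological principality and the final statement -/

/-- The range map is open, so an open set of non-unit isotropy arrows has an open image, consisting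
of units with non-trivial isotropy. -/
theorem EtaleGroupoid.IsTopologicallyPrincipal.isTopologicallyFree {G : Type*}
    [TopologicalSpace G] [EtaleGroupoid G] (hG : IsTopologicallyPrincipal G) :
    IsTopologicallyFree G := by
  intro V hV hVX hrd
  have hsub : (r : G → G) '' V ⊆
      interior {x : G | x ∈ unitSpace G ∧ ∃ γ : G, r γ = x ∧ d γ = x ∧ γ ≠ x} := by
    refine interior_maximal ?_ (isLocalHomeomorph_r.isOpenMap V hV)
    rintro _ ⟨γ, hγ, rfl⟩
    exact ⟨r_mem_unitSpace γ, γ, rfl, (hrd γ hγ).symm, fun h => hVX hγ h.symm⟩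
  rw [hG, Set.subset_empty_iff, Set.image_eq_empty] at hsub
  exact hsub

/-- Let `G` be a locally compact Hausdorff étale groupoid with a twist. (1) A reduced graded
completion of the convolution algebra is simple and contains `C_0(X)` as a maximal abelian
subalgebra iff `G` is topologically free and minimal. (2) This holds in particular for the reduced
`L^P`-operator algebras, `∅ ≠ P ⊆ [1, ∞]`. (3) If `G` is topologically principal and minimal, then
its reduced `L^p`-operator algebra is simple for each `p ∈ [1, ∞]`. -/
theorem corollaryB {𝕜 : Type*} [RCLike 𝕜] {G : Type*} [TopologicalSpace G] [T2Space G]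
    [LocallyCompactSpace G] [EtaleGroupoid G] {L : G → Type*}
    [∀ γ, NormedAddCommGroup (L γ)] [∀ γ, NormedSpace 𝕜 (L γ)]
    [TopologicalSpace (TotalSpace 𝕜 L)] (T : Twist 𝕜 L)
    {B : Type*} [NonUnitalNormedRing B] [NormedSpace 𝕜 B] [IsScalarTower 𝕜 B B]
    [SMulCommClass 𝕜 B B] (i : T.Cc →ₗ[𝕜] B) :
    (∀ S : Set (Set G), IsCoveringInverseSemigroup S →
      Twist.IsBanachCompletion i → Twist.IsGradedBy S i → Twist.IsReduced i →
      ((IsSimpleBanachAlgebra 𝕜 B ∧ IsMaximalAbelian 𝕜 (Twist.diagonal i)) ↔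
        (IsTopologicallyFree G ∧ IsMinimalGroupoid G))) ∧
    (∀ P : Set ℝ≥0∞, P.Nonempty → (∀ p ∈ P, 1 ≤ p) → Twist.IsReducedLpAlgebra P i →
      ((IsSimpleBanachAlgebra 𝕜 B ∧ IsMaximalAbelian 𝕜 (Twist.diagonal i)) ↔
        (IsTopologicallyFree G ∧ IsMinimalGroupoid G))) ∧
    (∀ p : ℝ≥0∞, 1 ≤ p → Twist.IsReducedLpAlgebra {p} i →
      IsTopologicallyPrincipal G → IsMinimalGroupoid G → IsSimpleBanachAlgebra 𝕜 B) := by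
  have hP : ∀ P : Set ℝ≥0∞, P.Nonempty → (∀ p ∈ P, 1 ≤ p) → Twist.IsReducedLpAlgebra P i →
      ((IsSimpleBanachAlgebra 𝕜 B ∧ IsMaximalAbelian 𝕜 (Twist.diagonal i)) ↔
        (IsTopologicallyFree G ∧ IsMinimalGroupoid G)) := fun P hne hP1 h =>
    Twist.isSimple_and_isMaximalAbelian_iff h.toIsBanachCompletion (h.isReduced hne hP1)
  refine ⟨fun S _ hi _ hr => Twist.isSimple_and_isMaximalAbelian_iff hi hr, hP,
    fun p hp h hG hG' => ?_⟩
  exact ((hP {p} (Set.singleton_nonempty p) (fun q hq => hq ▸ hp) h).2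
    ⟨IsTopologicallyPrincipal.isTopologicallyFree hG, hG'⟩).1
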